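/- Let $d\in\{1,2\}$, let $\xi,\xi_1,\xi_2,\dots$ be i.i.d. $\mathbb{Z}^d$-valued random variables on a probability space, put $S(n)=\xi_1+\dots+\xi_n$, and let $\varphi(t)=\mathbb{E}\,e^{it\cdot\xi}$. Let $$l(n,x)=\sum_{j=1}^n \mathbf{1}\{S(j)=x\}\quad(x\in\mathbb{Z}^d),\qquad L_n(k)=\sum_{x\in\mathbb{Z}^d} l(n,x)^k .$$ Assume that one of the following holds. - (A1) $d=1$; for some $\gamma>0$, $\varphi(t)=1-\gamma|t|+o(|t|)$ as $t\to0$; and the walk is strongly aperiodic, i.e. there are no proper subgroup $L$ of $\mathbb{Z}$ and $x\in\mathbb{Z}$ with $\mathbb{P}(\xi-x\in L)=1$. In this case put $\gamma_d=\gamma$. - (A2') $d=2$ and $\mathbb{P}(\xi=e)=1/4$ for each $e\in\mathbb{Z}^2$ with $|e|=1$ (simple random walk). In this case put $\gamma_d=2\sqrt{\det\Sigma}$, where $\Sigma$ is the covariance matrix of $\xi$ (so $\gamma_d=1$). Then for every integer $k\ge1$ the random variables $L_n(k)$ are square integrable and, as $n\to\infty$, $$\mathbb{E}L_n(k)\sim\frac{\Gamma(k+1)}{(\pi\gamma_d)^{k-1}}\,n(\log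 n)^{k-1},\qquad \operatorname{Var}(L_n(k))=O\big(n^2(\log n)^{2k-4}\big),$$ $$\frac{(\pi\gamma_d)^{k-1}}{n(\log n)^{k-1}}\,L_n(k)\longrightarrow\Gamma(k+1)\quad\text{almost surely.}$$ -/

import Mathlib

open MeasureTheory ProbabilityTheory Filter Topology Asymptotics

namespace LatticeWalk

noncomputable section

variable {d : ℕ} {Ω : Type*}

/-- The characteristic function `t ↦ E exp(i t·ξ)` of a law `μ` on `ℤ^d`. -/
def charFn (μ : Measure (Fin d → ℤ)) (t : EuclideanSpace ℝ (Fin d)) : ℂ :=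
  ∫ x, Complex.exp (Complex.I * ∑ j, (t j : ℂ) * (x j : ℂ)) ∂μ

/-- There is no proper subgroup `L` of `ℤ^d` such that `P(ξ - x ∈ L) = 1` for some `x`. -/
def StronglyAperiodic (μ : Measure (Fin d → ℤ)) : Prop :=
  ¬ ∃ L : AddSubgroup (Fin d → ℤ), L ≠ ⊤ ∧ ∃ x : Fin d → ℤ, μ {y | y - x ∈ L} = 1

/-- The characteristic function satisfies `φ(t) = 1 - γ |t| + o(|t|)` as `t → 0`, with `γ > 0`.
(Used for `d = 1`, where the Euclidean norm is the absolute value.) -/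
def HasOneStableExpansion (μ : Measure (Fin d → ℤ)) (γ : ℝ) : Prop :=
  0 < γ ∧
    (fun t : EuclideanSpace ℝ (Fin d) => charFn μ t - (1 - (γ : ℂ) * (‖t‖ : ℂ)))
      =o[𝓝 0] (fun t : EuclideanSpace ℝ (Fin d) => ‖t‖)

/-- The jump law gives mass `1/4` to each lattice point of Euclidean norm `1`.
(Used for `d = 2`: the simple random walk.) -/
def IsSimpleJump (μ : Measure (Fin d → ℤ)) : Prop :=
  ∀ e : Fin d → ℤ, ∑ i, e i ^ 2 = 1 → μ {e} = 1 / 4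

/-- The covariance matrix `Σ` of a law `μ` on `ℤ^d`. -/
def covMatrix (μ : Measure (Fin d → ℤ)) : Matrix (Fin d) (Fin d) ℝ :=
  Matrix.of fun i j => covariance (fun x : Fin d → ℤ => (x i : ℝ)) (fun x => (x j : ℝ)) μ

/-- The random walk after `n` steps; `ξ i` is the `(i+1)`-st jump, so `walk ξ 0 = 0`. -/
def walk (ξ : ℕ → Ω → Fin d → ℤ) (n : ℕ) (ω : Ω) : Fin d → ℤ :=
  ∑ i ∈ Finset.range n, ξ i ω

/-- The local time `l(n, x)`: the number of `1 ≤ j ≤ n` with `S(j) = x`. -/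
def localTime (ξ : ℕ → Ω → Fin d → ℤ) (n : ℕ) (x : Fin d → ℤ) (ω : Ω) : ℕ :=
  ∑ j ∈ Finset.Icc 1 n, if walk ξ j ω = x then 1 else 0

/-- The `k`-fold self-intersection local time `L_n(k) = ∑_{x ∈ ℤ^d} l(n, x)^k` (for `k ≥ 1`). -/
def selfIntersection (ξ : ℕ → Ω → Fin d → ℤ) (n k : ℕ) (ω : Ω) : ℝ :=
  ∑' x : Fin d → ℤ, (localTime ξ n x ω : ℝ) ^ k

/-- For `k ≥ 1` the series defining `L_n(k)` has only finitely many nonzero terms. -/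
theorem finite_support_localTime_pow (ξ : ℕ → Ω → Fin d → ℤ) (n k : ℕ) (hk : 1 ≤ k) (ω : Ω) :
    (Function.support fun x : Fin d → ℤ => (localTime ξ n x ω : ℝ) ^ k).Finite := by
  refine ((Finset.Icc 1 n).image fun j => walk ξ j ω).finite_toSet.subset ?_
  intro x hx
  by_contra hmem
  apply hx
  have h0 : localTime ξ n x ω = 0 := by
    refine Finset.sum_eq_zero fun j hj => if_neg fun h => hmem ?_
    exact Finset.mem_coe.2 (Finset.mem_image.2 ⟨j, hj, h⟩)
  have hk' : k ≠ 0 := by omega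
  simp [h0, hk']

end

end LatticeWalk

/-!
The argument rests on two facts about the step laws `stepLaw μ m`, the laws of `S(m)`: the uniform
bound `P(S(m) = x) ≤ C / (m + 1)` (`UniformLocalBound`), and `∑_{m < n} P(S(m) = 0) ~ log n / (πγ)`.
From these two facts alone, `selfIntersection_asymptotics` derives all the assertions.

*Expectation.* Expanding a power of a local time over the first visit that is used gives
`L_n(k) = ∑_{m ≤ n} (V_m^k - (V_m - 1)^k)`, where `V_m` is the number of visits to `S(m)` at times
in `[m, n]`; its law is that of the occupation count of the origin in `n + 1 - m` steps. The same
expansion gives a recursion for the moments of these counts, which shows that they are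
asymptotically those of an exponential variable with mean `log N / (πγ)`
(`tendsto_integral_visits_pow`). Summation over `m` yields `E L_n(k)`.

*Variance.* Split the walk at time `a`, and write `L_{a+b} = L_a + L'_b + X`, where `L_a` and `L'_b`
are the independent self-intersection local times of the two pieces and `X` collects their mutual
intersections. Seen from `S(a)`, the past and the future are two independent walks, so that
`E X²` factors into joint moments of occupation counts at two points `u`, `v`. Each of these is at
most a power of `log n` times `G(u) G(v - u) + G(v) G(u - v)`, with `G` Green's function
(`lintegral_visits_pow_mul_le_green`). As `∑ G² = O(n)`, this gives
`E X² = O(n² (log n)^{2k-4})` (`variance_cross_le`). With `a, b ≈ n/2`, the inequality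
`Var L_n ≤ 3/2 (Var L_a + Var L_b) + 3 Var X` contracts quantities of order `n²`, and the bound
follows by induction (`variance_selfIntersection_le`). No cancellation between joint probabilities
is needed, and periodicity of the walk plays no role.

*Almost sure convergence.* By Chebyshev's inequality in summed form, `L_n / E L_n → 1` along
`n_j = ⌈exp(j^{2/3})⌉`, since `∑ (log n_j)⁻² < ∞`; monotonicity of `n ↦ L_n` fills the gaps.

*The two facts.* For a one-dimensional walk with `φ(t) = 1 - γ|t| + o(|t|)`, strong aperiodicity and
compactness give `|φ(t)| ≤ exp(-c|t|)` on `[-π, π]`, and both facts follow from Fourier inversion,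
rescaling and dominated convergence. The planar simple random walk is, in the coordinates
`x₀ ± x₁`, a pair of independent simple random walks on `ℤ`, whose return probabilities are
given by Wallis' product.
-/

namespace LatticeWalk

open scoped ENNReal NNReal

variable {d : ℕ} {Ω : Type*}

/-! ### Walks with independent identically distributed jumps -/

/-- The jumps `ξ 0, ξ 1, …` are measurable, independent under `P`, and all have law `μ`. -/
structure IsIIDJumps [MeasurableSpace Ω] (P : Measure Ω) (μ : Measure (Fin d → ℤ))
    (ξ : ℕ → Ω → Fin d → ℤ) : Prop where
  meas : ∀ i, Measurable (ξ i)
  indep : iIndepFun ξ P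
  law : ∀ i, P.map (ξ i) = μ

/-- The number of times `0 ≤ j < N` at which the walk is at `x`. Unlike `localTime`, time `0`
counts. -/
def visits (ξ : ℕ → Ω → Fin d → ℤ) (N : ℕ) (x : Fin d → ℤ) (ω : Ω) : ℕ :=
  ∑ j ∈ Finset.range N, if walk ξ j ω = x then 1 else 0

/-- The jump sequence with its first `m` jumps removed. -/
def shift (m : ℕ) (ξ : ℕ → Ω → Fin d → ℤ) : ℕ → Ω → Fin d → ℤ := fun i => ξ (m + i)

/-- The jump sequence with the order of its first `a` jumps reversed. -/
def reverse (a : ℕ) (ξ : ℕ → Ω → Fin d → ℤ) : ℕ → Ω → Fin d → ℤ :=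
  fun i => ξ (if i < a then a - 1 - i else i)

/-- The law of the walk after `n` steps: the `n`-fold convolution power of `μ`. -/
noncomputable def stepLaw (μ : Measure (Fin d → ℤ)) : ℕ → Measure (Fin d → ℤ)
  | 0 => Measure.dirac 0
  | n + 1 => stepLaw μ n ∗ μ

instance isProbabilityMeasure_stepLaw (μ : Measure (Fin d → ℤ)) [IsProbabilityMeasure μ] (n : ℕ) :
    IsProbabilityMeasure (stepLaw μ n) := by
  induction n with
  | zero => unfold stepLaw; infer_instance
  | succ n ih => unfold stepLaw; infer_instance

lemma walk_add (ξ : ℕ → Ω → Fin d → ℤ) (m n : ℕ) (ω : Ω) :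
    walk ξ (m + n) ω = walk ξ m ω + walk (shift m ξ) n ω := by
  simp [walk, shift, Finset.sum_range_add]

lemma walk_reverse (ξ : ℕ → Ω → Fin d → ℤ) {a m : ℕ} (hm : m ≤ a) (ω : Ω) :
    walk (reverse a ξ) m ω = walk ξ a ω - walk ξ (a - m) ω := by
  induction m with
  | zero => simp [walk]
  | succ m ih =>
    have h1 : a - m = (a - (m + 1)) + 1 := by omega
    have h2 : a - 1 - m = a - (m + 1) := by omega
    have h3 : walk (reverse a ξ) (m + 1) ω = walk (reverse a ξ) m ω + ξ (a - (m + 1)) ω := by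
      simp only [walk, Finset.sum_range_succ, reverse]
      rw [if_pos (by omega), h2]
    have h4 : walk ξ (a - m) ω = walk ξ (a - (m + 1)) ω + ξ (a - (m + 1)) ω := by
      rw [h1]; simp only [walk, Finset.sum_range_succ]
    rw [h3, ih (by omega), h4]
    abel

lemma visits_mono (ξ : ℕ → Ω → Fin d → ℤ) {M N : ℕ} (h : M ≤ N) (x : Fin d → ℤ) (ω : Ω) :
    visits ξ M x ω ≤ visits ξ N x ω :=
  Finset.sum_le_sum_of_subset (Finset.range_mono h)

lemma localTime_le_visits (ξ : ℕ → Ω → Fin d → ℤ) (n : ℕ) (x : Fin d → ℤ) (ω : Ω) :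
    localTime ξ n x ω ≤ visits ξ (n + 1) x ω := by
  refine Finset.sum_le_sum_of_subset fun j hj => ?_
  simp only [Finset.mem_Icc, Finset.mem_range] at *
  omega

/-- The visits to `x` at times in `[m, N)` are visits of the walk restarted at time `m`. -/
lemma sum_Ico_eq_visits_shift (ξ : ℕ → Ω → Fin d → ℤ) (m N : ℕ) (x : Fin d → ℤ) (ω : Ω) :
    (∑ j ∈ Finset.Ico m N, if walk ξ j ω = x then 1 else 0)
      = visits (shift m ξ) (N - m) (x - walk ξ m ω) ω := by
  rw [Finset.sum_Ico_eq_sum_range, visits]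
  refine Finset.sum_congr rfl fun j _ => ?_
  rw [walk_add]
  congr 1
  rw [eq_sub_iff_add_eq, add_comm]

/-- Seen from the walker's position at time `a`, the past of the walk is a walk with reversed
jumps. -/
lemma localTime_eq_visits_reverse (ξ : ℕ → Ω → Fin d → ℤ) (a : ℕ) (x : Fin d → ℤ) (ω : Ω) :
    localTime ξ a x ω = visits (reverse a ξ) a (walk ξ a ω - x) ω := by
  rw [localTime, visits, ← Finset.sum_range_reflect]
  have : Finset.Icc 1 a = Finset.Ico 1 (a + 1) := by ext; simp
  rw [this, Finset.sum_Ico_eq_sum_range]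
  refine Finset.sum_congr (by simp) fun j hj => ?_
  have hj' : j < a := by simpa using hj
  rw [walk_reverse ξ (by omega)]
  have : a - (a - 1 - j) = 1 + j := by omega
  rw [this]
  congr 1
  rw [eq_iff_iff]
  constructor
  · intro h; rw [h]
  · intro h; simpa using h

lemma localTime_add (ξ : ℕ → Ω → Fin d → ℤ) (a b : ℕ) (x : Fin d → ℤ) (ω : Ω) :
    localTime ξ (a + b) x ω
      = localTime ξ a x ω + localTime (shift a ξ) b (x - walk ξ a ω) ω := by
  have hI : ∀ n, Finset.Icc 1 n = Finset.Ico 1 (n + 1) := fun n => by ext; simp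
  simp only [localTime, hI]
  rw [← Finset.sum_Ico_consecutive _ (show 1 ≤ a + 1 by omega) (show a + 1 ≤ a + b + 1 by omega)]
  congr 1
  rw [Finset.sum_Ico_eq_sum_range, Finset.sum_Ico_eq_sum_range]
  refine Finset.sum_congr (by congr 1; omega) fun j _ => ?_
  rw [show a + 1 + j = a + (1 + j) by ring, walk_add]
  congr 1
  rw [eq_sub_iff_add_eq, add_comm]

section Measurability

variable {mΩ : MeasurableSpace Ω} {ξ : ℕ → Ω → Fin d → ℤ}

lemma measurable_walk {n : ℕ} (h : ∀ i < n, Measurable (ξ i)) : Measurable (walk ξ n) := by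
  have : walk ξ n = fun ω => ∑ i ∈ Finset.range n, ξ i ω := rfl
  rw [this]
  exact Finset.measurable_fun_sum _ fun i hi => h i (by simpa using hi)

lemma measurable_visits {N : ℕ} (h : ∀ i < N, Measurable (ξ i)) (x : Fin d → ℤ) :
    Measurable (visits ξ N x) := by
  have : visits ξ N x = fun ω => ∑ j ∈ Finset.range N, if walk ξ j ω = x then 1 else 0 := rfl
  rw [this]
  refine Finset.measurable_fun_sum _ fun j hj => ?_
  have hj' : j < N := by simpa using hj
  exact Measurable.ite
    (measurable_walk (fun i hi => h i (hi.trans hj')) (measurableSet_singleton x))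
    measurable_const measurable_const

lemma measurable_localTime {n : ℕ} (h : ∀ i < n, Measurable (ξ i)) (x : Fin d → ℤ) :
    Measurable (localTime ξ n x) := by
  have : localTime ξ n x
      = fun ω => ∑ j ∈ Finset.Icc 1 n, if walk ξ j ω = x then 1 else 0 := rfl
  rw [this]
  refine Finset.measurable_fun_sum _ fun j hj => ?_
  have hj' : j ≤ n := (Finset.mem_Icc.1 hj).2
  exact Measurable.ite
    (measurable_walk (fun i hi => h i (hi.trans_le hj')) (measurableSet_singleton x))
    measurable_const measurable_const

end Measurability

namespace IsIIDJumps

/-- The σ-algebra generated by the jumps with index in `S`. -/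
abbrev sigma (ξ : ℕ → Ω → Fin d → ℤ) (S : Set ℕ) : MeasurableSpace Ω :=
  ⨆ i ∈ S, MeasurableSpace.comap (ξ i) inferInstance

lemma measurable_sigma (ξ : ℕ → Ω → Fin d → ℤ) {S : Set ℕ} {i : ℕ} (hi : i ∈ S) :
    Measurable[sigma ξ S] (ξ i) :=
  (comap_measurable (ξ i)).mono (le_iSup₂_of_le i hi le_rfl) le_rfl

lemma measurable_past (ξ : ℕ → Ω → Fin d → ℤ) (m : ℕ) :
    ∀ i < m, Measurable[sigma ξ (Set.Iio m)] (ξ i) :=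
  fun _ hi => measurable_sigma ξ hi

lemma measurable_future (ξ : ℕ → Ω → Fin d → ℤ) (m : ℕ) :
    ∀ i, Measurable[sigma ξ (Set.Ici m)] (LatticeWalk.shift m ξ i) :=
  fun i => measurable_sigma ξ (i := m + i) (by simp)

lemma measurable_past_reverse (ξ : ℕ → Ω → Fin d → ℤ) (m : ℕ) :
    ∀ i < m, Measurable[sigma ξ (Set.Iio m)] (LatticeWalk.reverse m ξ i) := by
  intro i hi
  simp only [LatticeWalk.reverse, if_pos hi]
  exact measurable_sigma ξ (by simp; omega)

variable [mΩ : MeasurableSpace Ω] {P : Measure Ω} {μ : Measure (Fin d → ℤ)}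
  {ξ : ℕ → Ω → Fin d → ℤ}

lemma precomp (h : IsIIDJumps P μ ξ) {g : ℕ → ℕ} (hg : Function.Injective g) :
    IsIIDJumps P μ (fun i => ξ (g i)) :=
  ⟨fun _ => h.meas _, h.indep.precomp hg, fun _ => h.law _⟩

lemma shift (h : IsIIDJumps P μ ξ) (m : ℕ) : IsIIDJumps P μ (shift m ξ) :=
  h.precomp (g := fun i => m + i) fun _ _ => by simp

lemma reverse (h : IsIIDJumps P μ ξ) (a : ℕ) : IsIIDJumps P μ (reverse a ξ) := by
  refine h.precomp (g := fun i => if i < a then a - 1 - i else i) fun i j hij => ?_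
  simp only at hij
  split_ifs at hij <;> omega

/-- Functions of disjoint blocks of jumps are independent. -/
lemma indepFun {α β : Type*} [MeasurableSpace α] [MeasurableSpace β]
    (h : IsIIDJumps P μ ξ) {S T : Set ℕ} (hST : Disjoint S T) {f : Ω → α} {g : Ω → β}
    (hf : Measurable[sigma ξ S] f) (hg : Measurable[sigma ξ T] g) : IndepFun f g P := by
  have := indep_iSup_of_disjoint (fun i => (h.meas i).comap_le) h.indep hST
  exact indep_of_indep_of_le_right (indep_of_indep_of_le_left this hf.comap_le) hg.comap_le

/-- Functions of the first `m` jumps are independent of functions of the others. -/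
lemma indepFun_past_future {α β : Type*} [MeasurableSpace α] [MeasurableSpace β]
    (h : IsIIDJumps P μ ξ) (m : ℕ) {f : Ω → α} {g : Ω → β}
    (hf : Measurable[sigma ξ (Set.Iio m)] f) (hg : Measurable[sigma ξ (Set.Ici m)] g) :
    IndepFun f g P :=
  h.indepFun (Set.Iio_disjoint_Ici le_rfl) hf hg

variable [IsProbabilityMeasure P]

lemma isProbabilityMeasure (h : IsIIDJumps P μ ξ) : IsProbabilityMeasure μ :=
  h.law 0 ▸ Measure.isProbabilityMeasure_map (h.meas 0).aemeasurable

lemma map_walk (h : IsIIDJumps P μ ξ) (n : ℕ) : P.map (walk ξ n) = stepLaw μ n := by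
  induction n with
  | zero =>
    have : walk ξ 0 = fun _ => 0 := by funext ω; simp [walk]
    rw [this, Measure.map_const]
    simp [stepLaw]
  | succ n ih =>
    have hw : walk ξ (n + 1) = walk ξ n + ξ n := by
      funext ω; simp [walk, Finset.sum_range_succ]
    have hi : IndepFun (walk ξ n) (ξ n) P :=
      h.indepFun_past_future n (measurable_walk (measurable_past ξ n))
        (measurable_sigma ξ (by simp))
    rw [hw, hi.map_add_eq_map_conv_map (measurable_walk fun i _ => h.meas i) (h.meas n), ih, h.law,
      stepLaw]

lemma measure_walk_eq (h : IsIIDJumps P μ ξ) (n : ℕ) (x : Fin d → ℤ) :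
    P {ω | walk ξ n ω = x} = stepLaw μ n {x} := by
  rw [← h.map_walk n, Measure.map_apply (measurable_walk fun i _ => h.meas i)
    (measurableSet_singleton x)]
  rfl

end IsIIDJumps

/-! ### Green's function and joint moments of occupation counts -/

/-- Green's function `∑_{m < N} P(S(m) = x)` of the walk up to time `N`. -/
noncomputable def green (μ : Measure (Fin d → ℤ)) (N : ℕ) (x : Fin d → ℤ) : ℝ≥0∞ :=
  ∑ m ∈ Finset.range N, stepLaw μ m {x}

lemma add_pow_le_pow_add_mul (y a i : ℕ) : (y + a) ^ i ≤ y ^ i + i * (a * (y + a) ^ (i - 1)) := by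
  induction i with
  | zero => simp
  | succ i ih =>
    rcases i with _ | i
    · simp
    · simp only [Nat.add_sub_cancel] at ih ⊢
      calc (y + a) ^ (i + 1 + 1) = a * (y + a) ^ (i + 1) + y * (y + a) ^ (i + 1) := by ring
        _ ≤ a * (y + a) ^ (i + 1) + y * (y ^ (i + 1) + (i + 1) * (a * (y + a) ^ i)) := by gcongr
        _ = y ^ (i + 1 + 1) + (a * (y + a) ^ (i + 1) + (i + 1) * (a * (y * (y + a) ^ i))) := by ring
        _ ≤ y ^ (i + 1 + 1) + (a * (y + a) ^ (i + 1)
              + (i + 1) * (a * ((y + a) * (y + a) ^ i))) := by gcongr; omega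
        _ = _ := by ring

/-- Telescoping of a product of powers of sums, over the first index that is used. -/
lemma sum_pow_mul_sum_pow_le (a b : ℕ → ℕ) (N i j : ℕ) (hij : i + j ≠ 0) :
    (∑ l ∈ Finset.range N, a l) ^ i * (∑ l ∈ Finset.range N, b l) ^ j ≤
      ∑ m ∈ Finset.range N,
        (a m * (i * ((∑ l ∈ Finset.Ico m N, a l) ^ (i - 1) * (∑ l ∈ Finset.Ico m N, b l) ^ j)) +
          b m * (j * ((∑ l ∈ Finset.Ico m N, a l) ^ i *
            (∑ l ∈ Finset.Ico m N, b l) ^ (j - 1)))) := by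
  set A : ℕ → ℕ := fun m => ∑ l ∈ Finset.Ico m N, a l with hA
  set B : ℕ → ℕ := fun m => ∑ l ∈ Finset.Ico m N, b l with hB
  have hstep : ∀ m ∈ Finset.range N, (A m ^ i * B m ^ j : ℤ) - A (m + 1) ^ i * B (m + 1) ^ j ≤
      ((a m * (i * (A m ^ (i - 1) * B m ^ j)) +
        b m * (j * (A m ^ i * B m ^ (j - 1))) : ℕ) : ℤ) := by
    intro m hm
    have hm' : m < N := by simpa using hm
    have h1 : A m = A (m + 1) + a m := by
      simp only [hA]; rw [Finset.sum_eq_sum_Ico_succ_bot hm', add_comm]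
    have h2 : B m = B (m + 1) + b m := by
      simp only [hB]; rw [Finset.sum_eq_sum_Ico_succ_bot hm', add_comm]
    have e1 := add_pow_le_pow_add_mul (A (m + 1)) (a m) i
    have e2 := add_pow_le_pow_add_mul (B (m + 1)) (b m) j
    rw [← h1] at e1
    rw [← h2] at e2
    have e3 : A (m + 1) ^ i ≤ A m ^ i := Nat.pow_le_pow_left (by omega) i
    have : A m ^ i * B m ^ j ≤ A (m + 1) ^ i * B (m + 1) ^ j +
        (a m * (i * (A m ^ (i - 1) * B m ^ j)) + b m * (j * (A m ^ i * B m ^ (j - 1)))) := by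
      calc A m ^ i * B m ^ j ≤ (A (m + 1) ^ i + i * (a m * A m ^ (i - 1))) * B m ^ j := by gcongr
        _ = A (m + 1) ^ i * B m ^ j + a m * (i * (A m ^ (i - 1) * B m ^ j)) := by ring
        _ ≤ A (m + 1) ^ i * (B (m + 1) ^ j + j * (b m * B m ^ (j - 1)))
              + a m * (i * (A m ^ (i - 1) * B m ^ j)) := by gcongr
        _ = A (m + 1) ^ i * B (m + 1) ^ j + A (m + 1) ^ i * (j * (b m * B m ^ (j - 1)))
              + a m * (i * (A m ^ (i - 1) * B m ^ j)) := by ring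
        _ ≤ A (m + 1) ^ i * B (m + 1) ^ j + A m ^ i * (j * (b m * B m ^ (j - 1)))
              + a m * (i * (A m ^ (i - 1) * B m ^ j)) := by gcongr
        _ = _ := by ring
    zify at this ⊢
    linarith
  have hsum := Finset.sum_le_sum hstep
  rw [Finset.sum_range_sub' (fun m => (A m ^ i * B m ^ j : ℤ))] at hsum
  have hN : (A N ^ i * B N ^ j : ℤ) = 0 := by
    simp only [hA, hB, Finset.Ico_self, Finset.sum_empty]
    rcases Nat.eq_zero_or_pos i with rfl | hi
    · have : j ≠ 0 := by omega
      simp [this]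
    · simp [hi.ne']
  have h0 : A 0 = ∑ l ∈ Finset.range N, a l := by simp [hA]
  have h0' : B 0 = ∑ l ∈ Finset.range N, b l := by simp [hB]
  rw [← h0, ← h0']
  rw [hN, sub_zero] at hsum
  exact_mod_cast hsum

lemma visits_pow_mul_le (ξ : ℕ → Ω → Fin d → ℤ) (N i j : ℕ) (hij : i + j ≠ 0) (u v : Fin d → ℤ)
    (ω : Ω) :
    visits ξ N u ω ^ i * visits ξ N v ω ^ j ≤
      ∑ m ∈ Finset.range N,
        ((if walk ξ m ω = u then 1 else 0) *
          (i * (visits (shift m ξ) N 0 ω ^ (i - 1) * visits (shift m ξ) N (v - u) ω ^ j)) +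
        (if walk ξ m ω = v then 1 else 0) *
          (j * (visits (shift m ξ) N (u - v) ω ^ i * visits (shift m ξ) N 0 ω ^ (j - 1)))) := by
  refine (sum_pow_mul_sum_pow_le _ _ N i j hij).trans (Finset.sum_le_sum fun m _ => ?_)
  rw [sum_Ico_eq_visits_shift ξ, sum_Ico_eq_visits_shift ξ]
  refine add_le_add ?_ ?_ <;> split_ifs with h
  · rw [h, sub_self]
    gcongr <;> exact visits_mono _ (Nat.sub_le _ _) _ _
  · simp
  · rw [h, sub_self]
    gcongr <;> exact visits_mono _ (Nat.sub_le _ _) _ _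
  · simp

section Moments

variable [MeasurableSpace Ω] {P : Measure Ω} {μ : Measure (Fin d → ℤ)} [IsProbabilityMeasure P]

/-- Markov property at time `m` on the event that the walk is at `u`. -/
lemma IsIIDJumps.lintegral_indicator_mul {ξ : ℕ → Ω → Fin d → ℤ} (h : IsIIDJumps P μ ξ) (m : ℕ)
    (u : Fin d → ℤ) {f : Ω → ℝ≥0∞} (hf : Measurable[sigma ξ (Set.Ici m)] f) :
    ∫⁻ ω, (if walk ξ m ω = u then 1 else 0) * f ω ∂P = stepLaw μ m {u} * ∫⁻ ω, f ω ∂P := by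
  have hle : sigma ξ (Set.Ici m) ≤ ‹MeasurableSpace Ω› :=
    iSup₂_le fun i _ => (h.meas i).comap_le
  have hm : ∀ {mΩ : MeasurableSpace Ω}, (∀ i < m, Measurable (ξ i)) →
      Measurable fun ω => (if walk ξ m ω = u then 1 else 0 : ℝ≥0∞) := fun hξ =>
    Measurable.ite (measurable_walk hξ (measurableSet_singleton u)) measurable_const
      measurable_const
  have hi := h.indepFun_past_future m (hm (measurable_past ξ m)) hf
  have := lintegral_mul_eq_lintegral_mul_lintegral_of_indepFun (hm fun i _ => h.meas i)
    (hf.mono hle le_rfl) hi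
  simp only [Pi.mul_apply] at this
  rw [this]
  congr 1
  rw [← h.measure_walk_eq]
  have hs : MeasurableSet {ω | walk ξ m ω = u} :=
    measurable_walk (fun i _ => h.meas i) (measurableSet_singleton u)
  rw [← lintegral_indicator_one hs]
  refine lintegral_congr fun ω => ?_
  simp [Set.indicator_apply]

/-- One step of the moment recursion: condition on the first visit that is counted. -/
lemma lintegral_visits_pow_mul_le {ξ : ℕ → Ω → Fin d → ℤ} (h : IsIIDJumps P μ ξ) (N i j : ℕ)
    (hij : i + j ≠ 0) (u v : Fin d → ℤ) {K₁ K₂ : ℝ≥0∞}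
    (h₁ : ∀ ξ' : ℕ → Ω → Fin d → ℤ, IsIIDJumps P μ ξ' →
      ∫⁻ ω, i * ((visits ξ' N 0 ω : ℝ≥0∞) ^ (i - 1) * (visits ξ' N (v - u) ω : ℝ≥0∞) ^ j) ∂P ≤ K₁)
    (h₂ : ∀ ξ' : ℕ → Ω → Fin d → ℤ, IsIIDJumps P μ ξ' →
      ∫⁻ ω, j * ((visits ξ' N (u - v) ω : ℝ≥0∞) ^ i * (visits ξ' N 0 ω : ℝ≥0∞) ^ (j - 1)) ∂P
        ≤ K₂) :
    ∫⁻ ω, (visits ξ N u ω : ℝ≥0∞) ^ i * (visits ξ N v ω : ℝ≥0∞) ^ j ∂P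
      ≤ green μ N u * K₁ + green μ N v * K₂ := by
  have hvis : ∀ {mΩ : MeasurableSpace Ω} (ξ' : ℕ → Ω → Fin d → ℤ) (x), (∀ i, Measurable (ξ' i)) →
      Measurable fun ω => (visits ξ' N x ω : ℝ≥0∞) := fun ξ' x hξ =>
    (measurable_of_countable (fun n : ℕ => (n : ℝ≥0∞))).comp (measurable_visits (fun i _ => hξ i) x)
  have hF₁ : ∀ m, Measurable[IsIIDJumps.sigma ξ (Set.Ici m)] fun ω => (i : ℝ≥0∞) *
      ((visits (shift m ξ) N 0 ω : ℝ≥0∞) ^ (i - 1) *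
        (visits (shift m ξ) N (v - u) ω : ℝ≥0∞) ^ j) := fun m => by
    have h0 := hvis (mΩ := IsIIDJumps.sigma ξ (Set.Ici m)) (shift m ξ) 0
      (IsIIDJumps.measurable_future ξ m)
    have h1 := hvis (mΩ := IsIIDJumps.sigma ξ (Set.Ici m)) (shift m ξ) (v - u)
      (IsIIDJumps.measurable_future ξ m)
    exact ((h0.pow_const _).mul (h1.pow_const _)).const_mul _
  have hF₂ : ∀ m, Measurable[IsIIDJumps.sigma ξ (Set.Ici m)] fun ω => (j : ℝ≥0∞) *
      ((visits (shift m ξ) N (u - v) ω : ℝ≥0∞) ^ i *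
        (visits (shift m ξ) N 0 ω : ℝ≥0∞) ^ (j - 1)) := fun m => by
    have h0 := hvis (mΩ := IsIIDJumps.sigma ξ (Set.Ici m)) (shift m ξ) 0
      (IsIIDJumps.measurable_future ξ m)
    have h1 := hvis (mΩ := IsIIDJumps.sigma ξ (Set.Ici m)) (shift m ξ) (u - v)
      (IsIIDJumps.measurable_future ξ m)
    exact ((h1.pow_const _).mul (h0.pow_const _)).const_mul _
  have hle : ∀ m, IsIIDJumps.sigma ξ (Set.Ici m) ≤ ‹MeasurableSpace Ω› := fun m =>
    iSup₂_le fun i _ => (h.meas i).comap_le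
  have hind : ∀ m x, Measurable fun ω => (if walk ξ m ω = x then 1 else 0 : ℝ≥0∞) := fun m x =>
    Measurable.ite (measurable_walk (fun i _ => h.meas i) (measurableSet_singleton x))
      measurable_const measurable_const
  calc ∫⁻ ω, (visits ξ N u ω : ℝ≥0∞) ^ i * (visits ξ N v ω : ℝ≥0∞) ^ j ∂P
      ≤ ∫⁻ ω, ∑ m ∈ Finset.range N,
        ((if walk ξ m ω = u then 1 else 0) * (i * ((visits (shift m ξ) N 0 ω : ℝ≥0∞) ^ (i - 1) *
            (visits (shift m ξ) N (v - u) ω : ℝ≥0∞) ^ j)) +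
        (if walk ξ m ω = v then 1 else 0) * (j * ((visits (shift m ξ) N (u - v) ω : ℝ≥0∞) ^ i *
            (visits (shift m ξ) N 0 ω : ℝ≥0∞) ^ (j - 1)))) ∂P := by
        refine lintegral_mono fun ω => ?_
        have := (Nat.cast_le (α := ℝ≥0∞)).2 (visits_pow_mul_le ξ N i j hij u v ω)
        push_cast at this
        exact this
    _ = ∑ m ∈ Finset.range N,
        (stepLaw μ m {u} * ∫⁻ ω, i * ((visits (shift m ξ) N 0 ω : ℝ≥0∞) ^ (i - 1) *
            (visits (shift m ξ) N (v - u) ω : ℝ≥0∞) ^ j) ∂P +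
        stepLaw μ m {v} * ∫⁻ ω, j * ((visits (shift m ξ) N (u - v) ω : ℝ≥0∞) ^ i *
            (visits (shift m ξ) N 0 ω : ℝ≥0∞) ^ (j - 1)) ∂P) := by
        have hG₁ := fun m => (hind m u).mul ((hF₁ m).mono (hle m) le_rfl)
        have hG₂ := fun m => (hind m v).mul ((hF₂ m).mono (hle m) le_rfl)
        refine (lintegral_finsetSum _ fun m _ => (hG₁ m).add (hG₂ m)).trans ?_
        refine Finset.sum_congr rfl fun m _ => ?_
        refine (lintegral_add_left (hG₁ m) _).trans ?_
        simp only [Pi.mul_apply]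
        rw [h.lintegral_indicator_mul m u (hF₁ m),
          h.lintegral_indicator_mul m v (hF₂ m)]
    _ ≤ ∑ m ∈ Finset.range N, (stepLaw μ m {u} * K₁ + stepLaw μ m {v} * K₂) := by
        refine Finset.sum_le_sum fun m _ => ?_
        gcongr
        · exact h₁ _ (h.shift m)
        · exact h₂ _ (h.shift m)
    _ = green μ N u * K₁ + green μ N v * K₂ := by
        rw [Finset.sum_add_distrib, green, green, Finset.sum_mul, Finset.sum_mul]

/-- Joint moments are at most those of independent visits, each costing a factor `H`. -/
lemma lintegral_visits_pow_mul_le_pow {H : ℝ≥0∞} {N : ℕ} (hH : ∀ x, green μ N x ≤ H) (i j : ℕ) :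
    ∀ (u v : Fin d → ℤ) (ξ : ℕ → Ω → Fin d → ℤ), IsIIDJumps P μ ξ →
      ∫⁻ ω, (visits ξ N u ω : ℝ≥0∞) ^ i * (visits ξ N v ω : ℝ≥0∞) ^ j ∂P
        ≤ (i + j).factorial * H ^ (i + j) := by
  induction hn : i + j generalizing i j with
  | zero =>
    intro u v ξ _
    obtain ⟨rfl, rfl⟩ : i = 0 ∧ j = 0 := by omega
    simp
  | succ n ih =>
    intro u v ξ h
    have h1 : ∀ ξ' : ℕ → Ω → Fin d → ℤ, IsIIDJumps P μ ξ' →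
        ∫⁻ ω, i * ((visits ξ' N 0 ω : ℝ≥0∞) ^ (i - 1) * (visits ξ' N (v - u) ω : ℝ≥0∞) ^ j) ∂P
          ≤ i * (n.factorial * H ^ n) := by
      intro ξ' h'
      rw [lintegral_const_mul' _ _ (by simp)]
      rcases Nat.eq_zero_or_pos i with rfl | hi
      · simp
      · gcongr; exact ih (i - 1) j (by omega) _ _ ξ' h'
    have h2 : ∀ ξ' : ℕ → Ω → Fin d → ℤ, IsIIDJumps P μ ξ' →
        ∫⁻ ω, j * ((visits ξ' N (u - v) ω : ℝ≥0∞) ^ i * (visits ξ' N 0 ω : ℝ≥0∞) ^ (j - 1)) ∂P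
          ≤ j * (n.factorial * H ^ n) := by
      intro ξ' h'
      rw [lintegral_const_mul' _ _ (by simp)]
      rcases Nat.eq_zero_or_pos j with rfl | hj
      · simp
      · gcongr; exact ih i (j - 1) (by omega) _ _ ξ' h'
    refine (lintegral_visits_pow_mul_le h N i j (by omega) u v h1 h2).trans ?_
    calc green μ N u * (i * (n.factorial * H ^ n)) + green μ N v * (j * (n.factorial * H ^ n))
        ≤ H * (i * (n.factorial * H ^ n)) + H * (j * (n.factorial * H ^ n)) := by
          gcongr <;> exact hH _
      _ = ((i + j : ℕ) : ℝ≥0∞) * n.factorial * H ^ (n + 1) := by push_cast; ring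
      _ = _ := by rw [hn, Nat.factorial_succ]; push_cast; ring

/-- If `v` is visited at all, then one of the visits costs Green's function at `v`. -/
lemma lintegral_visits_zero_pow_mul_le {H : ℝ≥0∞} {N : ℕ} (hH : ∀ x, green μ N x ≤ H)
    (v : Fin d → ℤ) (i j : ℕ) :
    ∀ (ξ : ℕ → Ω → Fin d → ℤ), IsIIDJumps P μ ξ →
      ∫⁻ ω, (visits ξ N 0 ω : ℝ≥0∞) ^ i * (visits ξ N v ω : ℝ≥0∞) ^ (j + 1) ∂P
        ≤ (i + j + 1).factorial * (H ^ (i + j) * green μ N v) := by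
  induction i with
  | zero =>
    intro ξ h
    have h1 : ∀ ξ' : ℕ → Ω → Fin d → ℤ, IsIIDJumps P μ ξ' →
        ∫⁻ ω, (0 : ℕ) * ((visits ξ' N 0 ω : ℝ≥0∞) ^ (0 - 1) *
          (visits ξ' N (v - 0) ω : ℝ≥0∞) ^ (j + 1)) ∂P ≤ 0 := by intro ξ' _; simp
    have h2 : ∀ ξ' : ℕ → Ω → Fin d → ℤ, IsIIDJumps P μ ξ' →
        ∫⁻ ω, (j + 1 : ℕ) * ((visits ξ' N (0 - v) ω : ℝ≥0∞) ^ 0 *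
          (visits ξ' N 0 ω : ℝ≥0∞) ^ (j + 1 - 1)) ∂P ≤
          (j + 1 : ℕ) * ((0 + j).factorial * H ^ (0 + j)) := by
      intro ξ' h'
      rw [lintegral_const_mul' _ _ (by simp)]
      gcongr
      exact lintegral_visits_pow_mul_le_pow hH 0 j _ _ ξ' h'
    refine (lintegral_visits_pow_mul_le h N 0 (j + 1) (by omega) 0 v h1 h2).trans (le_of_eq ?_)
    simp only [zero_add, Nat.factorial_succ]
    push_cast
    ring
  | succ i ih =>
    intro ξ h
    have h1 : ∀ ξ' : ℕ → Ω → Fin d → ℤ, IsIIDJumps P μ ξ' →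
        ∫⁻ ω, (i + 1 : ℕ) * ((visits ξ' N 0 ω : ℝ≥0∞) ^ (i + 1 - 1) *
          (visits ξ' N (v - 0) ω : ℝ≥0∞) ^ (j + 1)) ∂P ≤
          (i + 1 : ℕ) * ((i + j + 1).factorial * (H ^ (i + j) * green μ N v)) := by
      intro ξ' h'
      rw [lintegral_const_mul' _ _ (by simp), sub_zero]
      gcongr
      exact ih ξ' h'
    have h2 : ∀ ξ' : ℕ → Ω → Fin d → ℤ, IsIIDJumps P μ ξ' →
        ∫⁻ ω, (j + 1 : ℕ) * ((visits ξ' N (0 - v) ω : ℝ≥0∞) ^ (i + 1) *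
          (visits ξ' N 0 ω : ℝ≥0∞) ^ (j + 1 - 1)) ∂P ≤
          (j + 1 : ℕ) * ((i + 1 + j).factorial * H ^ (i + 1 + j)) := by
      intro ξ' h'
      rw [lintegral_const_mul' _ _ (by simp)]
      gcongr
      exact lintegral_visits_pow_mul_le_pow hH (i + 1) j _ _ ξ' h'
    refine (lintegral_visits_pow_mul_le h N (i + 1) (j + 1) (by omega) 0 v h1 h2).trans ?_
    calc _ ≤ H * ((i + 1 : ℕ) * ((i + j + 1).factorial * (H ^ (i + j) * green μ N v))) +
          green μ N v * ((j + 1 : ℕ) * ((i + 1 + j).factorial * H ^ (i + 1 + j))) := by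
          gcongr; exact hH _
      _ = _ := by
          rw [show i + 1 + j = i + j + 1 by ring, Nat.factorial_succ (i + j + 1)]
          push_cast
          ring

/-- The joint moment bound: beyond a power of `H`, one factor of Green's function is gained for
reaching the first of the two points and one for passing from it to the other. -/
lemma lintegral_visits_pow_mul_le_green {H : ℝ≥0∞} {N : ℕ} (hH : ∀ x, green μ N x ≤ H) (i j : ℕ)
    (u v : Fin d → ℤ) {ξ : ℕ → Ω → Fin d → ℤ} (h : IsIIDJumps P μ ξ) :
    ∫⁻ ω, (visits ξ N u ω : ℝ≥0∞) ^ (i + 1) * (visits ξ N v ω : ℝ≥0∞) ^ (j + 1) ∂P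
      ≤ (i + j + 2).factorial * (H ^ (i + j) *
        (green μ N u * green μ N (v - u) + green μ N v * green μ N (u - v))) := by
  -- restarted at the first visit to `u`, the walk sees the targets `0` and `v - u`
  have h1 : ∀ ξ' : ℕ → Ω → Fin d → ℤ, IsIIDJumps P μ ξ' →
      ∫⁻ ω, (i + 1 : ℕ) * ((visits ξ' N 0 ω : ℝ≥0∞) ^ (i + 1 - 1) *
        (visits ξ' N (v - u) ω : ℝ≥0∞) ^ (j + 1)) ∂P ≤
        (i + 1 : ℕ) * ((i + j + 1).factorial * (H ^ (i + j) * green μ N (v - u))) := by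
    intro ξ' h'
    rw [lintegral_const_mul' _ _ (by simp)]
    gcongr
    exact lintegral_visits_zero_pow_mul_le hH (v - u) i j ξ' h'
  have h2 : ∀ ξ' : ℕ → Ω → Fin d → ℤ, IsIIDJumps P μ ξ' →
      ∫⁻ ω, (j + 1 : ℕ) * ((visits ξ' N (u - v) ω : ℝ≥0∞) ^ (i + 1) *
        (visits ξ' N 0 ω : ℝ≥0∞) ^ (j + 1 - 1)) ∂P ≤
        (j + 1 : ℕ) * ((i + j + 1).factorial * (H ^ (i + j) * green μ N (u - v))) := by
    intro ξ' h'
    rw [lintegral_const_mul' _ _ (by simp)]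
    gcongr
    simp only [Nat.add_sub_cancel, mul_comm ((visits ξ' N (u - v) _ : ℝ≥0∞) ^ (i + 1))]
    rw [add_comm i j]
    exact lintegral_visits_zero_pow_mul_le hH (u - v) j i ξ' h'
  refine (lintegral_visits_pow_mul_le h N (i + 1) (j + 1) (by omega) u v h1 h2).trans ?_
  calc _ ≤ ((i + j + 2 : ℕ) : ℝ≥0∞) * (i + j + 1).factorial * (H ^ (i + j) *
        (green μ N u * green μ N (v - u) + green μ N v * green μ N (u - v))) := by
        have e1 : ((i + 1 : ℕ) : ℝ≥0∞) ≤ ((i + j + 2 : ℕ) : ℝ≥0∞) := by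
          exact_mod_cast (by omega : i + 1 ≤ i + j + 2)
        have e2 : ((j + 1 : ℕ) : ℝ≥0∞) ≤ ((i + j + 2 : ℕ) : ℝ≥0∞) := by
          exact_mod_cast (by omega : j + 1 ≤ i + j + 2)
        calc _ ≤ green μ N u * ((i + j + 2 : ℕ) * ((i + j + 1).factorial *
                (H ^ (i + j) * green μ N (v - u)))) +
              green μ N v * ((i + j + 2 : ℕ) * ((i + j + 1).factorial *
                (H ^ (i + j) * green μ N (u - v)))) := by gcongr
          _ = _ := by ring
    _ = _ := by rw [Nat.factorial_succ (i + j + 1)]; push_cast; ring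

end Moments

/-! ### Local central limit bounds for Green's function -/

lemma tsum_stepLaw_singleton (μ : Measure (Fin d → ℤ)) [IsProbabilityMeasure μ] (m : ℕ) :
    ∑' x, stepLaw μ m {x} = 1 := by
  have := lintegral_countable' (μ := stepLaw μ m) (fun _ => 1)
  simpa using this.symm

/-- `P(S(m) = x)` is `O(1/m)` uniformly in `x`, with the constant `C`. -/
def UniformLocalBound (μ : Measure (Fin d → ℤ)) (C : ℝ≥0∞) : Prop :=
  ∀ (m : ℕ) (x : Fin d → ℤ), stepLaw μ m {x} ≤ C / (m + 1 : ℕ)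

lemma UniformLocalBound.green_le {μ : Measure (Fin d → ℤ)} {C : ℝ≥0∞}
    (hC : UniformLocalBound μ C) (N : ℕ) (x : Fin d → ℤ) :
    green μ N x ≤ ∑ m ∈ Finset.range N, C / (m + 1 : ℕ) :=
  Finset.sum_le_sum fun m _ => hC m x

lemma UniformLocalBound.tsum_mul_le {μ : Measure (Fin d → ℤ)} [IsProbabilityMeasure μ] {C : ℝ≥0∞}
    (hC : UniformLocalBound μ C) (m m' : ℕ) :
    ∑' x, stepLaw μ m {x} * stepLaw μ m' {x} ≤ C / (m' + 1 : ℕ) := by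
  calc ∑' x, stepLaw μ m {x} * stepLaw μ m' {x}
      ≤ ∑' x, stepLaw μ m {x} * (C / (m' + 1 : ℕ)) :=
        ENNReal.tsum_le_tsum fun x => by gcongr; exact hC m' x
    _ = C / (m' + 1 : ℕ) := by rw [ENNReal.tsum_mul_right, tsum_stepLaw_singleton, one_mul]

/-- Two independent walks of length `N` meet `O(N)` times on average. -/
lemma UniformLocalBound.tsum_green_sq_le {μ : Measure (Fin d → ℤ)} [IsProbabilityMeasure μ]
    {C : ℝ≥0∞} (hC : UniformLocalBound μ C) (N : ℕ) :
    ∑' x, green μ N x ^ 2 ≤ 2 * (N * C) := by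
  -- the `m' + 1` terms with `m ≤ m'` use the bound at the larger time `m'`
  have hsum : ∀ m' : ℕ, ∑ m ∈ Finset.range N, (if m ≤ m' then C / (m' + 1 : ℕ) else 0) ≤ C := by
    intro m'
    rw [← Finset.sum_filter, Finset.sum_const, nsmul_eq_mul]
    have hcard : ((Finset.range N).filter (fun m => m ≤ m')).card ≤ m' + 1 := by
      calc _ ≤ (Finset.range (m' + 1)).card := Finset.card_le_card fun m hm => by
            simp only [Finset.mem_filter, Finset.mem_range] at *; omega
        _ = m' + 1 := Finset.card_range _
    calc _ ≤ ((m' + 1 : ℕ) : ℝ≥0∞) * (C / (m' + 1 : ℕ)) := by gcongr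
      _ = C := ENNReal.mul_div_cancel (by simp) (by simp)
  calc ∑' x, green μ N x ^ 2
      = ∑ m ∈ Finset.range N, ∑ m' ∈ Finset.range N,
          ∑' x, stepLaw μ m {x} * stepLaw μ m' {x} := by
        simp_rw [green, sq, Finset.sum_mul_sum]
        rw [Summable.tsum_finsetSum fun _ _ => ENNReal.summable]
        refine Finset.sum_congr rfl fun m _ => ?_
        rw [Summable.tsum_finsetSum fun _ _ => ENNReal.summable]
    _ ≤ ∑ m ∈ Finset.range N, ∑ m' ∈ Finset.range N,
          ((if m ≤ m' then C / (m' + 1 : ℕ) else 0) +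
            (if m' ≤ m then C / (m + 1 : ℕ) else 0)) := by
        refine Finset.sum_le_sum fun m _ => Finset.sum_le_sum fun m' _ => ?_
        rcases le_total m m' with h | h
        · rw [if_pos h]; exact (hC.tsum_mul_le m m').trans le_self_add
        · rw [if_pos h]
          simp_rw [mul_comm (stepLaw μ m _)]
          exact (hC.tsum_mul_le m' m).trans le_add_self
    _ ≤ N * C + N * C := by
        simp_rw [Finset.sum_add_distrib]
        refine add_le_add ?_ ?_
        · rw [Finset.sum_comm]
          exact (Finset.sum_le_sum fun m' _ => hsum m').trans (by simp)
        · exact (Finset.sum_le_sum fun m _ => hsum m).trans (by simp)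
    _ = 2 * (N * C) := by ring

/-! ### The variance of the self-intersection local time -/

lemma green_mono (μ : Measure (Fin d → ℤ)) {M N : ℕ} (h : M ≤ N) (x : Fin d → ℤ) :
    green μ M x ≤ green μ N x :=
  Finset.sum_le_sum_of_subset (Finset.range_mono h)

lemma ennreal_add_mul_add_le (a b c e : ℝ≥0∞) :
    (a + b) * (c + e) ≤ 2 * (a ^ 2 + b ^ 2 + c ^ 2 + e ^ 2) := by
  have h : ∀ x y : ℝ≥0∞, x * y ≤ x ^ 2 + y ^ 2 := fun x y => by
    rcases le_total x y with hxy | hxy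
    · calc x * y ≤ y * y := by gcongr
        _ = y ^ 2 := (sq y).symm
        _ ≤ _ := le_add_self
    · calc x * y ≤ x * x := by gcongr
        _ = x ^ 2 := (sq x).symm
        _ ≤ _ := le_self_add
  calc (a + b) * (c + e) = a * c + a * e + (b * c + b * e) := by ring
    _ ≤ (a ^ 2 + c ^ 2) + (a ^ 2 + e ^ 2) + ((b ^ 2 + c ^ 2) + (b ^ 2 + e ^ 2)) := by
        gcongr <;> exact h _ _
    _ = _ := by ring

/-- By Cauchy–Schwarz, the four terms that arise when two independent walks both visit `u` and `v`
are controlled by the expected number of meetings of two walks. -/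
lemma tsum_tsum_green_le (g : (Fin d → ℤ) → ℝ≥0∞) :
    ∑' u, ∑' v, (g (-u) * g (u - v) + g (-v) * g (v - u)) * (g u * g (v - u) + g v * g (u - v))
      ≤ 8 * (∑' x, g x ^ 2) ^ 2 := by
  set D := ∑' x, g x ^ 2 with hD
  have hneg : ∑' x, g (-x) ^ 2 = D := (Equiv.neg (Fin d → ℤ)).tsum_eq (fun x => g x ^ 2)
  have hsubl : ∀ u, ∑' v, g (u - v) ^ 2 = D := fun u =>
    (Equiv.subLeft u).tsum_eq (fun x => g x ^ 2)
  have hsubr : ∀ u, ∑' v, g (v - u) ^ 2 = D := fun u =>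
    (Equiv.subRight u).tsum_eq (fun x => g x ^ 2)
  have e1 : ∑' u, ∑' v, (g (-u) * g (u - v)) ^ 2 = D ^ 2 := by
    simp_rw [mul_pow, ENNReal.tsum_mul_left, hsubl, ENNReal.tsum_mul_right, hneg, sq]
  have e2 : ∑' u, ∑' v, (g (-v) * g (v - u)) ^ 2 = D ^ 2 := by
    rw [ENNReal.tsum_comm, e1]
  have e3 : ∑' u, ∑' v, (g u * g (v - u)) ^ 2 = D ^ 2 := by
    simp_rw [mul_pow, ENNReal.tsum_mul_left, hsubr, ENNReal.tsum_mul_right, ← hD, sq]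
  have e4 : ∑' u, ∑' v, (g v * g (u - v)) ^ 2 = D ^ 2 := by
    rw [ENNReal.tsum_comm, e3]
  calc _ ≤ ∑' u, ∑' v, 2 * ((g (-u) * g (u - v)) ^ 2 + (g (-v) * g (v - u)) ^ 2
          + (g u * g (v - u)) ^ 2 + (g v * g (u - v)) ^ 2) :=
        ENNReal.tsum_le_tsum fun u => ENNReal.tsum_le_tsum fun v => ennreal_add_mul_add_le _ _ _ _
    _ = 8 * D ^ 2 := by
        simp_rw [ENNReal.tsum_mul_left, ENNReal.tsum_add, e1, e2, e3, e4]
        ring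

lemma measurable_visits_pow {mΩ : MeasurableSpace Ω} {ξ : ℕ → Ω → Fin d → ℤ} {N : ℕ}
    (h : ∀ i < N, Measurable (ξ i)) (x : Fin d → ℤ) (i : ℕ) :
    Measurable fun ω => (visits ξ N x ω : ℝ≥0∞) ^ i :=
  (measurable_of_countable (fun n : ℕ => (n : ℝ≥0∞) ^ i)).comp (measurable_visits h x)

section CrossTerm

variable [MeasurableSpace Ω] {P : Measure Ω} {μ : Measure (Fin d → ℤ)} [IsProbabilityMeasure P]

/-- Second moment of the mutual intersections of the walk before and after time `a`, as seen from
its position at time `a`. -/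
lemma lintegral_mutual_sq_le {ξ : ℕ → Ω → Fin d → ℤ} (h : IsIIDJumps P μ ξ) {C H : ℝ≥0∞}
    (hC : UniformLocalBound μ C) {N a b : ℕ} (hH : ∀ x, green μ N x ≤ H) (ha : a ≤ N) (hb : b ≤ N)
    (i j : ℕ) :
    ∫⁻ ω, (∑' u, (visits (reverse a ξ) a (-u) ω : ℝ≥0∞) ^ (i + 1) *
        (visits (shift a ξ) b u ω : ℝ≥0∞) ^ (j + 1)) ^ 2 ∂P
      ≤ (i + i + 2).factorial * (j + j + 2).factorial * H ^ (i + i + (j + j)) *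
          (8 * (2 * (N * C)) ^ 2) := by
  have : IsProbabilityMeasure μ := h.isProbabilityMeasure
  set A : (Fin d → ℤ) → Ω → ℝ≥0∞ :=
    fun u ω => (visits (reverse a ξ) a (-u) ω : ℝ≥0∞) ^ (i + 1) with hA
  set B : (Fin d → ℤ) → Ω → ℝ≥0∞ :=
    fun u ω => (visits (shift a ξ) b u ω : ℝ≥0∞) ^ (j + 1) with hB
  have mA : ∀ u, Measurable (A u) := fun u =>
    measurable_visits_pow (fun i _ => (h.reverse a).meas i) _ _
  have mB : ∀ u, Measurable (B u) := fun u =>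
    measurable_visits_pow (fun i _ => (h.shift a).meas i) _ _
  have mA' : ∀ u, Measurable[IsIIDJumps.sigma ξ (Set.Iio a)] (A u) := fun u =>
    measurable_visits_pow (IsIIDJumps.measurable_past_reverse ξ a) _ _
  have mB' : ∀ u, Measurable[IsIIDJumps.sigma ξ (Set.Ici a)] (B u) := fun u =>
    measurable_visits_pow (fun i _ => IsIIDJumps.measurable_future ξ a i) _ _
  have hfac : ∀ u v, ∫⁻ ω, (A u ω * B u ω) * (A v ω * B v ω) ∂P
      = (∫⁻ ω, A u ω * A v ω ∂P) * ∫⁻ ω, B u ω * B v ω ∂P := by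
    intro u v
    have hi : IndepFun (A u * A v) (B u * B v) P :=
      h.indepFun_past_future a (Measurable.mul (mA' u) (mA' v)) (Measurable.mul (mB' u) (mB' v))
    have := lintegral_mul_eq_lintegral_mul_lintegral_of_indepFun ((mA u).mul (mA v))
      ((mB u).mul (mB v)) hi
    simp only [Pi.mul_apply] at this
    rw [← this]
    exact lintegral_congr fun ω => by ring
  have hAA : ∀ u v, ∫⁻ ω, A u ω * A v ω ∂P ≤ (i + i + 2).factorial * (H ^ (i + i) *
      (green μ N (-u) * green μ N (u - v) + green μ N (-v) * green μ N (v - u))) := by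
    intro u v
    refine (lintegral_visits_pow_mul_le_green (fun x => (green_mono μ ha x).trans (hH x)) i i
      (-u) (-v) (h.reverse a)).trans ?_
    rw [show -v - -u = u - v by abel, show -u - -v = v - u by abel]
    gcongr <;> exact green_mono μ ha _
  have hBB : ∀ u v, ∫⁻ ω, B u ω * B v ω ∂P ≤ (j + j + 2).factorial * (H ^ (j + j) *
      (green μ N u * green μ N (v - u) + green μ N v * green μ N (u - v))) := by
    intro u v
    refine (lintegral_visits_pow_mul_le_green (fun x => (green_mono μ hb x).trans (hH x)) j j
      u v (h.shift a)).trans ?_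
    gcongr <;> exact green_mono μ hb _
  calc ∫⁻ ω, (∑' u, A u ω * B u ω) ^ 2 ∂P
      = ∑' u, ∑' v, ∫⁻ ω, (A u ω * B u ω) * (A v ω * B v ω) ∂P := by
        have mAB : ∀ u, Measurable fun ω => A u ω * B u ω := fun u => (mA u).mul (mB u)
        simp_rw [sq, ← ENNReal.tsum_mul_right, ← ENNReal.tsum_mul_left]
        have mAB2 : ∀ u v, Measurable fun ω => A u ω * B u ω * (A v ω * B v ω) :=
          fun u v => (mAB u).mul (mAB v)
        rw [lintegral_tsum fun u => (Measurable.tsum fun v => mAB2 u v).aemeasurable]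
        congr 1
        ext u
        rw [lintegral_tsum fun v => (mAB2 u v).aemeasurable]
    _ ≤ ∑' u, ∑' v, ((i + i + 2).factorial * (j + j + 2).factorial * H ^ (i + i + (j + j))) *
        ((green μ N (-u) * green μ N (u - v) + green μ N (-v) * green μ N (v - u)) *
          (green μ N u * green μ N (v - u) + green μ N v * green μ N (u - v))) := by
        refine ENNReal.tsum_le_tsum fun u => ENNReal.tsum_le_tsum fun v => ?_
        rw [hfac]
        refine (mul_le_mul' (hAA u v) (hBB u v)).trans (le_of_eq ?_)
        rw [pow_add H]
        ring
    _ ≤ _ := by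
        simp_rw [ENNReal.tsum_mul_left]
        gcongr
        refine (tsum_tsum_green_le _).trans ?_
        gcongr
        exact hC.tsum_green_sq_le N

end CrossTerm

lemma localTime_eq_zero {ξ : ℕ → Ω → Fin d → ℤ} {n : ℕ} {x : Fin d → ℤ} {ω : Ω}
    (hx : x ∉ (Finset.Icc 1 n).image fun j => walk ξ j ω) : localTime ξ n x ω = 0 :=
  Finset.sum_eq_zero fun j hj => if_neg fun h => hx (Finset.mem_image.2 ⟨j, hj, h⟩)

/-- `L_n(k)` is a finite sum over the range of the walk. -/
lemma selfIntersection_eq_sum (ξ : ℕ → Ω → Fin d → ℤ) (n : ℕ) {k : ℕ} (hk : 1 ≤ k) (ω : Ω) :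
    selfIntersection ξ n k ω
      = ∑ x ∈ (Finset.Icc 1 n).image fun j => walk ξ j ω, (localTime ξ n x ω : ℝ) ^ k :=
  tsum_eq_sum fun x hx => by
    rw [localTime_eq_zero hx, Nat.cast_zero, zero_pow (by omega)]

lemma selfIntersection_nonneg (ξ : ℕ → Ω → Fin d → ℤ) (n k : ℕ) (ω : Ω) :
    0 ≤ selfIntersection ξ n k ω :=
  tsum_nonneg fun _ => by positivity

lemma ofReal_selfIntersection (ξ : ℕ → Ω → Fin d → ℤ) (n : ℕ) {k : ℕ} (hk : 1 ≤ k) (ω : Ω) :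
    ENNReal.ofReal (selfIntersection ξ n k ω) = ∑' x, (localTime ξ n x ω : ℝ≥0∞) ^ k := by
  have h := finite_support_localTime_pow ξ n k hk ω
  rw [selfIntersection, ENNReal.ofReal_tsum_of_nonneg (fun _ => by positivity)
    (summable_of_hasFiniteSupport h)]
  congr 1
  ext x
  rw [ENNReal.ofReal_pow (by positivity), ENNReal.ofReal_natCast]

lemma measurable_selfIntersection {mΩ : MeasurableSpace Ω} {ξ : ℕ → Ω → Fin d → ℤ} {n : ℕ}
    (h : ∀ i < n, Measurable (ξ i)) {k : ℕ} (hk : 1 ≤ k) :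
    Measurable (selfIntersection ξ n k) := by
  have : selfIntersection ξ n k = fun ω => (∑' x, (localTime ξ n x ω : ℝ≥0∞) ^ k).toReal := by
    funext ω
    rw [← ofReal_selfIntersection ξ n hk, ENNReal.toReal_ofReal (selfIntersection_nonneg _ _ _ _)]
  rw [this]
  exact (Measurable.tsum fun x => (measurable_of_countable
    (fun n : ℕ => (n : ℝ≥0∞) ^ k)).comp (measurable_localTime h x)).ennreal_toReal

lemma localTime_le (ξ : ℕ → Ω → Fin d → ℤ) (n : ℕ) (x : Fin d → ℤ) (ω : Ω) :
    localTime ξ n x ω ≤ n := by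
  calc localTime ξ n x ω ≤ ∑ _j ∈ Finset.Icc 1 n, 1 :=
        Finset.sum_le_sum fun j _ => by split_ifs <;> simp
    _ = n := by simp

lemma selfIntersection_le (ξ : ℕ → Ω → Fin d → ℤ) (n : ℕ) {k : ℕ} (hk : 1 ≤ k) (ω : Ω) :
    selfIntersection ξ n k ω ≤ n * (n : ℝ) ^ k := by
  rw [selfIntersection_eq_sum ξ n hk]
  calc _ ≤ ∑ x ∈ (Finset.Icc 1 n).image fun j => walk ξ j ω, (n : ℝ) ^ k := by
        refine Finset.sum_le_sum fun x _ => ?_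
        gcongr
        exact_mod_cast localTime_le ξ n x ω
    _ = (((Finset.Icc 1 n).image fun j => walk ξ j ω).card : ℝ) * (n : ℝ) ^ k := by simp
    _ ≤ _ := by
        gcongr
        exact (Finset.card_image_le).trans (by simp)

section Variance

variable [MeasurableSpace Ω] {P : Measure Ω} {μ : Measure (Fin d → ℤ)} [IsProbabilityMeasure P]

lemma memLp_selfIntersection {ξ : ℕ → Ω → Fin d → ℤ} (h : ∀ i, Measurable (ξ i)) (n : ℕ) {k : ℕ}
    (hk : 1 ≤ k) (p : ℝ≥0∞) : MemLp (selfIntersection ξ n k) p P :=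
  MemLp.of_bound (measurable_selfIntersection (fun i _ => h i) hk).aestronglyMeasurable
    (n * (n : ℝ) ^ k) <| ae_of_all _ fun ω => by
      rw [Real.norm_of_nonneg (selfIntersection_nonneg _ _ _ _)]
      exact selfIntersection_le ξ n hk ω

lemma variance_selfIntersection_le_pow {ξ : ℕ → Ω → Fin d → ℤ} (h : ∀ i, Measurable (ξ i)) (n : ℕ)
    {k : ℕ} (hk : 1 ≤ k) : Var[selfIntersection ξ n k; P] ≤ (n * (n : ℝ) ^ k) ^ 2 := by
  have hm := (measurable_selfIntersection (n := n) (fun i _ => h i) hk)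
  refine (variance_le_expectation_sq hm.aestronglyMeasurable).trans ?_
  calc ∫ ω, (selfIntersection ξ n k ^ 2) ω ∂P ≤ ∫ _, (n * (n : ℝ) ^ k) ^ 2 ∂P := by
        refine integral_mono (memLp_selfIntersection h n hk 2).integrable_sq
          (integrable_const _) fun ω => ?_
        exact pow_le_pow_left₀ (selfIntersection_nonneg _ _ _ _) (selfIntersection_le ξ n hk ω) 2
    _ = _ := by simp

/-- From `0 ≤ Var (X - 2 Y)`. The factor `3/2` of `Var X` is less than `2`, which is what halving
the walk can afford. -/
lemma variance_add_le {X Y : Ω → ℝ} (hX : MemLp X 2 P) (hY : MemLp Y 2 P) :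
    Var[X + Y; P] ≤ 3 / 2 * Var[X; P] + 3 * Var[Y; P] := by
  have h1 := variance_add hX hY
  have h2 := variance_sub hX (hY.const_mul 2)
  have h3 : cov[X, fun ω => 2 * Y ω; P] = 2 * cov[X, Y; P] := covariance_const_mul_right 2
  have h4 : Var[fun ω => 2 * Y ω; P] = 2 ^ 2 * Var[Y; P] := variance_const_mul 2 Y P
  rw [h3, h4] at h2
  have h5 := variance_nonneg (X - fun ω => 2 * Y ω) P
  linarith

end Variance

lemma add_pow_le_add_cross (a b κ : ℕ) : (a + b) ^ (κ + 2) ≤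
    a ^ (κ + 2) + b ^ (κ + 2) + 3 ^ (κ + 2) * (a ^ (κ + 1) * b + a * b ^ (κ + 1)) := by
  induction κ with
  | zero => ring_nf; nlinarith [Nat.zero_le (a * b)]
  | succ κ ih =>
    have hr : a * b ^ (κ + 1) + b * a ^ (κ + 1) ≤ a * a ^ (κ + 1) + b * b ^ (κ + 1) := by
      rcases le_total a b with h | h
      · exact mul_add_mul_le_mul_add_mul h (Nat.pow_le_pow_left h _)
      · have := mul_add_mul_le_mul_add_mul h (Nat.pow_le_pow_left h (κ + 1))
        linarith
    have hr' : a * b * (a * b ^ κ + b * a ^ κ) ≤ a * b * (a * a ^ κ + b * b ^ κ) := by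
      refine Nat.mul_le_mul_left _ ?_
      rcases le_total a b with h | h
      · exact mul_add_mul_le_mul_add_mul h (Nat.pow_le_pow_left h _)
      · have := mul_add_mul_le_mul_add_mul h (Nat.pow_le_pow_left h κ)
        linarith
    have h3 : 1 ≤ 3 ^ (κ + 2) := Nat.one_le_pow _ _ (by norm_num)
    set E := a ^ (κ + 2) * b + a * b ^ (κ + 2) with hE
    calc (a + b) ^ (κ + 1 + 2) = (a + b) * (a + b) ^ (κ + 2) := by ring
      _ ≤ (a + b) * (a ^ (κ + 2) + b ^ (κ + 2)
            + 3 ^ (κ + 2) * (a ^ (κ + 1) * b + a * b ^ (κ + 1))) := by gcongr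
      _ = a ^ (κ + 3) + b ^ (κ + 3) + E + 3 ^ (κ + 2) * E
            + 3 ^ (κ + 2) * (a * b * (a * b ^ κ + b * a ^ κ)) := by rw [hE]; ring
      _ ≤ a ^ (κ + 3) + b ^ (κ + 3) + 3 ^ (κ + 2) * E + 3 ^ (κ + 2) * E
            + 3 ^ (κ + 2) * (a * b * (a * a ^ κ + b * b ^ κ)) := by
          gcongr
          exact Nat.le_mul_of_pos_left _ (by omega)
      _ = a ^ (κ + 1 + 2) + b ^ (κ + 1 + 2) + 3 ^ (κ + 1 + 2) *
            (a ^ (κ + 1 + 1) * b + a * b ^ (κ + 1 + 1)) := by rw [hE]; ring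

/-- `L_{a+b}(k)` exceeds the sum of the self-intersections of the two pieces of the walk by at most
a multiple of their mutual intersections. -/
lemma tsum_localTime_add_le (ξ : ℕ → Ω → Fin d → ℤ) (a b κ : ℕ) (ω : Ω) :
    ∑' x, (localTime ξ (a + b) x ω : ℝ≥0∞) ^ (κ + 2) ≤
      ∑' x, (localTime ξ a x ω : ℝ≥0∞) ^ (κ + 2) +
      ∑' x, (localTime (shift a ξ) b x ω : ℝ≥0∞) ^ (κ + 2) +
      3 ^ (κ + 2) *
        (∑' u, (visits (reverse a ξ) a (-u) ω : ℝ≥0∞) ^ (κ + 1) *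
          (visits (shift a ξ) (b + 1) u ω : ℝ≥0∞) ^ (0 + 1) +
        ∑' u, (visits (reverse a ξ) a (-u) ω : ℝ≥0∞) ^ (0 + 1) *
          (visits (shift a ξ) (b + 1) u ω : ℝ≥0∞) ^ (κ + 1)) := by
  set S := walk ξ a ω with hS
  have hre : ∀ f : (Fin d → ℤ) → ℝ≥0∞, ∑' x, f x = ∑' u, f (u + S) := fun f =>
    ((Equiv.addRight S).tsum_eq f).symm
  rw [hre fun x => (localTime ξ (a + b) x ω : ℝ≥0∞) ^ (κ + 2),
    hre fun x => (localTime ξ a x ω : ℝ≥0∞) ^ (κ + 2), ← ENNReal.tsum_add, ← ENNReal.tsum_add,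
    ← ENNReal.tsum_mul_left, ← ENNReal.tsum_add]
  refine ENNReal.tsum_le_tsum fun u => ?_
  have h1 : localTime ξ (a + b) (u + S) ω
      = visits (reverse a ξ) a (-u) ω + localTime (shift a ξ) b u ω := by
    rw [localTime_add, localTime_eq_visits_reverse ξ a, ← hS]
    congr 2 <;> abel
  have h2 : localTime ξ a (u + S) ω = visits (reverse a ξ) a (-u) ω := by
    rw [localTime_eq_visits_reverse ξ a, ← hS]
    congr 1; abel
  rw [h1, h2]
  have h3 := add_pow_le_add_cross (visits (reverse a ξ) a (-u) ω) (localTime (shift a ξ) b u ω) κ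
  have h4 := localTime_le_visits (shift a ξ) b u ω
  have h5 : (visits (reverse a ξ) a (-u) ω + localTime (shift a ξ) b u ω) ^ (κ + 2) ≤
      visits (reverse a ξ) a (-u) ω ^ (κ + 2) + localTime (shift a ξ) b u ω ^ (κ + 2) +
      3 ^ (κ + 2) * (visits (reverse a ξ) a (-u) ω ^ (κ + 1) *
          visits (shift a ξ) (b + 1) u ω ^ (0 + 1) +
        visits (reverse a ξ) a (-u) ω ^ (0 + 1) * visits (shift a ξ) (b + 1) u ω ^ (κ + 1)) := by
    refine h3.trans ?_
    rw [zero_add, pow_one, pow_one]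
    gcongr
  have h6 := (Nat.cast_le (α := ℝ≥0∞)).2 h5
  push_cast at h6 ⊢
  exact h6

lemma le_tsum_localTime_add (ξ : ℕ → Ω → Fin d → ℤ) (a b κ : ℕ) (ω : Ω) :
    ∑' x, (localTime ξ a x ω : ℝ≥0∞) ^ (κ + 2) +
      ∑' x, (localTime (shift a ξ) b x ω : ℝ≥0∞) ^ (κ + 2) ≤
      ∑' x, (localTime ξ (a + b) x ω : ℝ≥0∞) ^ (κ + 2) := by
  set S := walk ξ a ω with hS
  have hre : ∀ f : (Fin d → ℤ) → ℝ≥0∞, ∑' u, f u = ∑' x, f (x - S) := fun f =>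
    ((Equiv.subRight S).tsum_eq f).symm
  rw [hre fun x => (localTime (shift a ξ) b x ω : ℝ≥0∞) ^ (κ + 2), ← ENNReal.tsum_add]
  refine ENNReal.tsum_le_tsum fun x => ?_
  rw [localTime_add, ← hS]
  push_cast
  exact pow_add_pow_le zero_le zero_le (by omega)

lemma harmonic_nonneg (n : ℕ) : (0 : ℝ) ≤ harmonic n := by
  simp only [harmonic]; push_cast; positivity

lemma harmonic_mono {m n : ℕ} (h : m ≤ n) : (harmonic m : ℝ) ≤ harmonic n := by
  simp only [harmonic]
  push_cast
  exact Finset.sum_le_sum_of_subset_of_nonneg (Finset.range_mono h) fun _ _ _ => by positivity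

lemma UniformLocalBound.green_le_harmonic {μ : Measure (Fin d → ℤ)} {C : ℝ≥0}
    (hC : UniformLocalBound μ C) (N : ℕ) (x : Fin d → ℤ) :
    green μ N x ≤ ENNReal.ofReal (C * harmonic N) := by
  refine (hC.green_le N x).trans (le_of_eq ?_)
  simp only [harmonic]
  push_cast
  rw [Finset.mul_sum, ENNReal.ofReal_sum_of_nonneg fun _ _ => by positivity]
  refine Finset.sum_congr rfl fun m _ => ?_
  rw [ENNReal.ofReal_mul (by positivity), ENNReal.ofReal_coe_nnreal,
    ENNReal.ofReal_inv_of_pos (by positivity), div_eq_mul_inv]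
  congr 2
  rw [ENNReal.ofReal_add (by positivity) (by positivity)]
  simp

section Variance

variable [MeasurableSpace Ω] {P : Measure Ω} {μ : Measure (Fin d → ℤ)} [IsProbabilityMeasure P]

/-- The part of `L_{a+b}(k)` due to mutual intersections has the order of magnitude of the standard
deviation bound; no cancellation is needed for it. -/
lemma variance_cross_le {C : ℝ≥0} (hC : UniformLocalBound μ C) (κ : ℕ) :
    ∃ K : ℝ, 0 ≤ K ∧ ∀ (ξ : ℕ → Ω → Fin d → ℤ), IsIIDJumps P μ ξ → ∀ a b n : ℕ, a + b = n →
      Var[selfIntersection ξ n (κ + 2) - (selfIntersection ξ a (κ + 2) +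
        selfIntersection (shift a ξ) b (κ + 2)); P]
        ≤ K * ((n + 1 : ℝ) ^ 2 * (harmonic (n + 1) : ℝ) ^ (2 * κ)) := by
  refine ⟨4 * (3 ^ (κ + 2)) ^ 2 * (2 * ((κ + κ + 2).factorial * 2 * C ^ (2 * κ) *
    (8 * (2 * C) ^ 2))), by positivity, ?_⟩
  rintro ξ h a b n rfl
  have hk : 1 ≤ κ + 2 := by omega
  set X := selfIntersection ξ (a + b) (κ + 2) - (selfIntersection ξ a (κ + 2) +
    selfIntersection (shift a ξ) b (κ + 2)) with hX
  set N := a + b + 1 with hN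
  set H := ENNReal.ofReal (C * harmonic N) with hH
  set Y₁ : Ω → ℝ≥0∞ := fun ω => ∑' u, (visits (reverse a ξ) a (-u) ω : ℝ≥0∞) ^ (κ + 1) *
    (visits (shift a ξ) (b + 1) u ω : ℝ≥0∞) ^ (0 + 1) with hY₁
  set Y₂ : Ω → ℝ≥0∞ := fun ω => ∑' u, (visits (reverse a ξ) a (-u) ω : ℝ≥0∞) ^ (0 + 1) *
    (visits (shift a ξ) (b + 1) u ω : ℝ≥0∞) ^ (κ + 1) with hY₂
  have mY₁ : Measurable Y₁ := Measurable.tsum fun u =>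
    (measurable_visits_pow (fun i _ => (h.reverse a).meas i) _ _).mul
      (measurable_visits_pow (fun i _ => (h.shift a).meas i) _ _)
  have hXm : Measurable X :=
    (measurable_selfIntersection (fun i _ => h.meas i) hk).sub
      ((measurable_selfIntersection (fun i _ => h.meas i) hk).add
        (measurable_selfIntersection (fun i _ => (h.shift a).meas i) hk))
  have hXle : ∀ ω, ENNReal.ofReal (X ω) ≤ 3 ^ (κ + 2) * (Y₁ ω + Y₂ ω) := by
    intro ω
    simp only [hX, Pi.sub_apply, Pi.add_apply]
    rw [ENNReal.ofReal_sub _ (add_nonneg (selfIntersection_nonneg _ _ _ _)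
        (selfIntersection_nonneg _ _ _ _)),
      ENNReal.ofReal_add (selfIntersection_nonneg _ _ _ _) (selfIntersection_nonneg _ _ _ _),
      ofReal_selfIntersection _ _ hk, ofReal_selfIntersection _ _ hk,
      ofReal_selfIntersection _ _ hk]
    exact tsub_le_iff_left.2 (tsum_localTime_add_le ξ a b κ ω)
  have hXnn : ∀ ω, 0 ≤ X ω := by
    intro ω
    simp only [hX, Pi.sub_apply, Pi.add_apply, sub_nonneg]
    have := le_tsum_localTime_add ξ a b κ ω
    rw [← ofReal_selfIntersection _ _ hk, ← ofReal_selfIntersection _ _ hk,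
      ← ofReal_selfIntersection _ _ hk, ← ENNReal.ofReal_add (selfIntersection_nonneg _ _ _ _)
        (selfIntersection_nonneg _ _ _ _)] at this
    exact (ENNReal.ofReal_le_ofReal_iff (selfIntersection_nonneg _ _ _ _)).1 this
  have b₁ := lintegral_mutual_sq_le h hC (N := N) (a := a) (b := b + 1)
    (hC.green_le_harmonic N) (by omega) (by omega) κ 0
  have b₂ := lintegral_mutual_sq_le h hC (N := N) (a := a) (b := b + 1)
    (hC.green_le_harmonic N) (by omega) (by omega) 0 κ
  set B : ℝ≥0∞ := (κ + κ + 2).factorial * 2 * H ^ (2 * κ) * (8 * (2 * (N * C)) ^ 2) with hB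
  have hfac : ((0 + 0 + 2).factorial : ℝ≥0∞) = 2 := by norm_num [Nat.factorial]
  have b₁' : ∫⁻ ω, Y₁ ω ^ 2 ∂P ≤ B := b₁.trans (le_of_eq (by
    rw [hB, ← hH, hfac, show κ + κ + (0 + 0) = 2 * κ by ring]))
  have b₂' : ∫⁻ ω, Y₂ ω ^ 2 ∂P ≤ B := b₂.trans (le_of_eq (by
    rw [hB, ← hH, hfac, show 0 + 0 + (κ + κ) = 2 * κ by ring]; ring))
  clear b₁ b₂
  have hlint : ∫⁻ ω, ENNReal.ofReal (X ω ^ 2) ∂P ≤ 4 * (3 ^ (κ + 2)) ^ 2 * (2 * B) := by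
    calc ∫⁻ ω, ENNReal.ofReal (X ω ^ 2) ∂P
        ≤ ∫⁻ ω, 4 * (3 ^ (κ + 2)) ^ 2 * (Y₁ ω ^ 2 + Y₂ ω ^ 2) ∂P := by
          refine lintegral_mono fun ω => ?_
          rw [ENNReal.ofReal_pow (hXnn ω)]
          have hsq : (Y₁ ω + Y₂ ω) ^ 2 ≤ 4 * (Y₁ ω ^ 2 + Y₂ ω ^ 2) := by
            rw [sq (Y₁ ω + Y₂ ω)]
            exact (ennreal_add_mul_add_le _ _ _ _).trans (le_of_eq (by ring))
          calc _ ≤ (3 ^ (κ + 2) * (Y₁ ω + Y₂ ω)) ^ 2 := by gcongr; exact hXle ω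
            _ = (3 ^ (κ + 2)) ^ 2 * (Y₁ ω + Y₂ ω) ^ 2 := by ring
            _ ≤ (3 ^ (κ + 2)) ^ 2 * (4 * (Y₁ ω ^ 2 + Y₂ ω ^ 2)) := by gcongr
            _ = _ := by ring
      _ = 4 * (3 ^ (κ + 2)) ^ 2 * (∫⁻ ω, Y₁ ω ^ 2 ∂P + ∫⁻ ω, Y₂ ω ^ 2 ∂P) := by
          rw [lintegral_const_mul' _ _ (by finiteness), lintegral_add_left (mY₁.pow_const 2)]
      _ ≤ 4 * (3 ^ (κ + 2)) ^ 2 * (B + B) := by gcongr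
      _ = _ := by ring
  have hBfin : 4 * (3 ^ (κ + 2)) ^ 2 * (2 * B) ≠ ⊤ := by
    rw [hB, hH]; finiteness
  calc Var[X; P] ≤ ∫ ω, (X ^ 2) ω ∂P := variance_le_expectation_sq hXm.aestronglyMeasurable
    _ = (∫⁻ ω, ENNReal.ofReal (X ω ^ 2) ∂P).toReal :=
        integral_eq_lintegral_of_nonneg_ae (ae_of_all _ fun ω => sq_nonneg (X ω))
          (hXm.pow_const 2).aestronglyMeasurable
    _ ≤ (4 * (3 ^ (κ + 2)) ^ 2 * (2 * B)).toReal := ENNReal.toReal_mono hBfin hlint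
    _ = _ := by
        have := harmonic_nonneg N
        rw [hB, hH]
        simp only [ENNReal.toReal_mul, ENNReal.toReal_pow, ENNReal.toReal_ofNat,
          ENNReal.toReal_natCast, ENNReal.coe_toReal]
        rw [ENNReal.toReal_ofReal (by positivity), hN]
        push_cast
        ring

/-- The variance bound, by halving the walk: `Var L_n ≤ 3/2 (Var L_a + Var L_b) + 3 Var X` with
`a, b ≈ n/2` loses only a factor `3/4` on quantities of order `n²`. -/
theorem variance_selfIntersection_le {C : ℝ≥0} (hC : UniformLocalBound μ C) (κ : ℕ) :
    ∃ K : ℝ, 0 ≤ K ∧ ∀ (n : ℕ) (ξ : ℕ → Ω → Fin d → ℤ), IsIIDJumps P μ ξ →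
      Var[selfIntersection ξ n (κ + 2); P]
        ≤ K * ((n : ℝ) ^ 2 * (harmonic (n + 1) : ℝ) ^ (2 * κ)) := by
  obtain ⟨K₀, hK₀, hX⟩ := variance_cross_le (P := P) hC κ
  have hk : 1 ≤ κ + 2 := by omega
  refine ⟨72 * K₀ + 1, by positivity, fun n => ?_⟩
  induction n using Nat.strong_induction_on with
  | _ n ih =>
    intro ξ h
    have hn1 : 1 ≤ (harmonic (n + 1) : ℝ) := by
      refine le_trans ?_ (harmonic_mono (show 1 ≤ n + 1 by omega))
      simp [harmonic]
    rcases Nat.lt_or_ge n 2 with hn | hn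
    -- lengths `0` and `1` obey the trivial bound, which accounts for the `+ 1` in the constant
    · have := variance_selfIntersection_le_pow (P := P) h.meas n hk
      have hp : 1 ≤ (harmonic (n + 1) : ℝ) ^ (2 * κ) := one_le_pow₀ hn1
      refine this.trans ?_
      interval_cases n
      · simp
      · simp only [Nat.cast_one, one_pow, mul_one, one_mul]
        nlinarith
    · set a := n / 2 with ha
      set b := n - a with hb
      have hab : a + b = n := by omega
      have va := ih a (by omega) ξ h
      have vb := ih b (by omega) (shift a ξ) (h.shift a)
      have vx := hX ξ h a b n hab
      have mL : ∀ m (ξ : ℕ → Ω → Fin d → ℤ), IsIIDJumps P μ ξ →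
          MemLp (selfIntersection ξ m (κ + 2)) 2 P := fun m ξ h =>
        memLp_selfIntersection h.meas m hk 2
      have hind : IndepFun (selfIntersection ξ a (κ + 2))
          (selfIntersection (shift a ξ) b (κ + 2)) P :=
        h.indepFun_past_future a (measurable_selfIntersection (IsIIDJumps.measurable_past ξ a) hk)
          (measurable_selfIntersection (fun i _ => IsIIDJumps.measurable_future ξ a i) hk)
      have hsum := hind.variance_add (mL a ξ h) (mL b _ (h.shift a))
      have hle := variance_add_le ((mL a ξ h).add (mL b _ (h.shift a)))
        ((mL n ξ h).sub ((mL a ξ h).add (mL b _ (h.shift a))))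
      rw [add_sub_cancel, hsum] at hle
      set Λ := (harmonic (n + 1) : ℝ) ^ (2 * κ) with hΛ
      have hΛ0 : 0 ≤ Λ := pow_nonneg (harmonic_nonneg _) _
      have hΛa : (harmonic (a + 1) : ℝ) ^ (2 * κ) ≤ Λ :=
        pow_le_pow_left₀ (harmonic_nonneg _) (harmonic_mono (by omega)) _
      have hΛb : (harmonic (b + 1) : ℝ) ^ (2 * κ) ≤ Λ :=
        pow_le_pow_left₀ (harmonic_nonneg _) (harmonic_mono (by omega)) _
      have va' : Var[selfIntersection ξ a (κ + 2); P] ≤ (72 * K₀ + 1) * ((a : ℝ) ^ 2 * Λ) :=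
        va.trans (by gcongr)
      have vb' : Var[selfIntersection (shift a ξ) b (κ + 2); P]
          ≤ (72 * K₀ + 1) * ((b : ℝ) ^ 2 * Λ) := vb.trans (by gcongr)
      -- the worst case is `n = 3`, and `3/2 * 5/9 = 5/6 < 1` makes the induction close
      have hnab : (a : ℝ) ^ 2 + (b : ℝ) ^ 2 ≤ 5 / 9 * (n : ℝ) ^ 2 := by
        have : 9 * (a ^ 2 + b ^ 2) ≤ 5 * n ^ 2 := by
          rcases Nat.even_or_odd' n with ⟨c, hc | hc⟩
          · have h1 : a = c := by omega
            have h2 : b = c := by omega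
            rw [h1, h2, hc]; nlinarith
          · have h1 : a = c := by omega
            have h2 : b = c + 1 := by omega
            have h3 : 1 ≤ c := by omega
            rw [h1, h2, hc]; nlinarith
        have h' : (9 * ((a : ℝ) ^ 2 + (b : ℝ) ^ 2)) ≤ 5 * (n : ℝ) ^ 2 := by exact_mod_cast this
        linarith
      have hn2 : ((n : ℝ) + 1) ^ 2 ≤ 4 * (n : ℝ) ^ 2 := by
        have : (2 : ℝ) ≤ n := by exact_mod_cast hn
        nlinarith
      have vx' : 3 * Var[selfIntersection ξ n (κ + 2) - (selfIntersection ξ a (κ + 2) +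
          selfIntersection (shift a ξ) b (κ + 2)); P] ≤ 12 * K₀ * ((n : ℝ) ^ 2 * Λ) := by
        calc _ ≤ 3 * (K₀ * ((4 * (n : ℝ) ^ 2) * Λ)) := by
              gcongr; exact vx.trans (by gcongr)
          _ = _ := by ring
      calc _ ≤ 3 / 2 * ((72 * K₀ + 1) * ((a : ℝ) ^ 2 * Λ) + (72 * K₀ + 1) * ((b : ℝ) ^ 2 * Λ))
            + 12 * K₀ * ((n : ℝ) ^ 2 * Λ) := by linarith
        _ = 3 / 2 * (72 * K₀ + 1) * ((a : ℝ) ^ 2 + (b : ℝ) ^ 2) * Λ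
            + 12 * K₀ * ((n : ℝ) ^ 2 * Λ) := by ring
        _ ≤ 3 / 2 * (72 * K₀ + 1) * (5 / 9 * (n : ℝ) ^ 2) * Λ
            + 12 * K₀ * ((n : ℝ) ^ 2 * Λ) := by gcongr
        _ ≤ _ := by
            have : 0 ≤ (n : ℝ) ^ 2 * Λ := by positivity
            nlinarith

end Variance

/-! ### Exact moment formulas by first visits -/

/-- The increment `t^i - (t-1)^i` at a natural number `t`, and `0` at `t = 0` when `i ≥ 1`. -/
noncomputable def powDiff (i t : ℕ) : ℝ := (t : ℝ) ^ i - ((t - 1 : ℕ) : ℝ) ^ i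

lemma powDiff_succ_zero (i : ℕ) : powDiff (i + 1) 0 = 0 := by simp [powDiff]

lemma powDiff_eq_sum (i : ℕ) {t : ℕ} (ht : 1 ≤ t) :
    powDiff (i + 1) t
      = ∑ l ∈ Finset.range (i + 1), (t : ℝ) ^ l * ((t - 1 : ℕ) : ℝ) ^ (i + 1 - 1 - l) := by
  have h : (t : ℝ) - ((t - 1 : ℕ) : ℝ) = 1 := by rw [Nat.cast_sub ht]; simp
  have := (Commute.all (t : ℝ) ((t - 1 : ℕ) : ℝ)).geom_sum₂_mul (i + 1)
  rw [h, mul_one] at this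
  rw [this, powDiff]

lemma powDiff_succ_nonneg (i t : ℕ) : 0 ≤ powDiff (i + 1) t := by
  rw [powDiff, sub_nonneg]
  gcongr
  omega

lemma powDiff_succ_mono (i : ℕ) {s t : ℕ} (h : s ≤ t) : powDiff (i + 1) s ≤ powDiff (i + 1) t := by
  rcases Nat.eq_zero_or_pos s with rfl | hs
  · rw [powDiff_succ_zero]; exact powDiff_succ_nonneg i t
  · rw [powDiff_eq_sum i hs, powDiff_eq_sum i (hs.trans_le h)]
    gcongr

lemma powDiff_succ_le (i : ℕ) {t : ℕ} (ht : 1 ≤ t) :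
    powDiff (i + 1) t ≤ (i + 1) * (t : ℝ) ^ i := by
  rw [powDiff_eq_sum i ht]
  calc _ ≤ ∑ l ∈ Finset.range (i + 1), (t : ℝ) ^ i := by
        refine Finset.sum_le_sum fun l hl => ?_
        have hl' : l ≤ i := by simp at hl; omega
        calc (t : ℝ) ^ l * ((t - 1 : ℕ) : ℝ) ^ (i + 1 - 1 - l)
            ≤ (t : ℝ) ^ l * (t : ℝ) ^ (i + 1 - 1 - l) := by gcongr; omega
          _ = (t : ℝ) ^ i := by rw [← pow_add]; congr 1; omega
    _ = _ := by simp

lemma le_powDiff_succ (i : ℕ) {t : ℕ} (ht : 1 ≤ t) :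
    (i + 1) * ((t : ℝ) ^ i - i * (t : ℝ) ^ (i - 1)) ≤ powDiff (i + 1) t := by
  have h1 : (t : ℝ) ^ i - i * (t : ℝ) ^ (i - 1) ≤ ((t - 1 : ℕ) : ℝ) ^ i := by
    rcases i with _ | i
    · simp
    · have := powDiff_succ_le i ht
      rw [powDiff] at this
      push_cast
      linarith
  rw [powDiff_eq_sum i ht]
  calc _ ≤ (i + 1) * ((t - 1 : ℕ) : ℝ) ^ i := by gcongr
    _ = ∑ l ∈ Finset.range (i + 1), ((t - 1 : ℕ) : ℝ) ^ i := by simp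
    _ ≤ _ := by
        refine Finset.sum_le_sum fun l hl => ?_
        have hl' : l ≤ i := by simp at hl; omega
        calc ((t - 1 : ℕ) : ℝ) ^ i
            = ((t - 1 : ℕ) : ℝ) ^ l * ((t - 1 : ℕ) : ℝ) ^ (i + 1 - 1 - l) := by
              rw [← pow_add]; congr 1; omega
          _ ≤ _ := by gcongr; omega

/-- A power of a number of successes, expanded over the index of the first success that is used. -/
lemma sum_pow_eq_sum_powDiff (p : ℕ → Prop) [DecidablePred p] {a N : ℕ} (haN : a ≤ N) (i : ℕ) :
    ((∑ l ∈ Finset.Ico a N, if p l then 1 else 0 : ℕ) : ℝ) ^ (i + 1) =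
      ∑ m ∈ Finset.Ico a N, (if p m then 1 else 0) *
        powDiff (i + 1) (∑ l ∈ Finset.Ico m N, if p l then 1 else 0) := by
  induction haN using Nat.decreasingInduction with
  | self => simp
  | of_succ a ha ih =>
    rw [Finset.sum_eq_sum_Ico_succ_bot ha, Finset.sum_eq_sum_Ico_succ_bot ha, ← ih]
    by_cases hp : p a
    · have : (∑ l ∈ Finset.Ico a N, if p l then 1 else 0)
          = 1 + ∑ l ∈ Finset.Ico (a + 1) N, if p l then 1 else 0 := by
        rw [Finset.sum_eq_sum_Ico_succ_bot ha, if_pos hp]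
      rw [this, powDiff]
      simp [hp]
    · simp [hp]

lemma visits_pow_eq (ξ : ℕ → Ω → Fin d → ℤ) (N i : ℕ) (ω : Ω) :
    (visits ξ N 0 ω : ℝ) ^ (i + 1) = ∑ m ∈ Finset.range N, (if walk ξ m ω = 0 then 1 else 0) *
      powDiff (i + 1) (visits (shift m ξ) (N - m) 0 ω) := by
  have := sum_pow_eq_sum_powDiff (fun m => walk ξ m ω = 0) (Nat.zero_le N) i
  rw [← Finset.range_eq_Ico] at this
  rw [visits, this]
  refine Finset.sum_congr rfl fun m _ => ?_
  by_cases h : walk ξ m ω = 0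
  · rw [sum_Ico_eq_visits_shift ξ, h, sub_zero]
  · simp [h]

/-- `L_n(k)` as a sum over times of increments of powers of numbers of future returns. -/
lemma selfIntersection_eq_sum_powDiff (ξ : ℕ → Ω → Fin d → ℤ) (n i : ℕ) (ω : Ω) :
    selfIntersection ξ n (i + 1) ω
      = ∑ m ∈ Finset.Ico 1 (n + 1), powDiff (i + 1) (visits (shift m ξ) (n + 1 - m) 0 ω) := by
  have hI : Finset.Icc 1 n = Finset.Ico 1 (n + 1) := by ext; simp
  rw [selfIntersection_eq_sum ξ n (by omega)]
  simp only [localTime, hI]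
  simp_rw [fun x => sum_pow_eq_sum_powDiff (fun m => walk ξ m ω = x)
    (show 1 ≤ n + 1 by omega) i]
  rw [Finset.sum_comm]
  refine Finset.sum_congr rfl fun m hm => ?_
  simp_rw [ite_mul, one_mul, zero_mul]
  rw [Finset.sum_ite_eq, if_pos (Finset.mem_image_of_mem _ hm), sum_Ico_eq_visits_shift ξ,
    sub_self]

lemma visits_le (ξ : ℕ → Ω → Fin d → ℤ) (N : ℕ) (x : Fin d → ℤ) (ω : Ω) : visits ξ N x ω ≤ N := by
  calc visits ξ N x ω ≤ ∑ _j ∈ Finset.range N, 1 :=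
        Finset.sum_le_sum fun j _ => by split_ifs <;> simp
    _ = N := by simp

lemma one_le_visits_zero (ξ : ℕ → Ω → Fin d → ℤ) {N : ℕ} (hN : 1 ≤ N) (ω : Ω) :
    1 ≤ visits ξ N 0 ω := by
  refine le_trans ?_ (visits_mono ξ hN 0 ω)
  simp [visits, walk]

section Expectation

variable [MeasurableSpace Ω] {P : Measure Ω} {μ : Measure (Fin d → ℤ)} [IsProbabilityMeasure P]

lemma integrable_comp_visits {ξ : ℕ → Ω → Fin d → ℤ} (h : ∀ i, Measurable (ξ i)) (N : ℕ)
    (x : Fin d → ℤ) (f : ℕ → ℝ) : Integrable (fun ω => f (visits ξ N x ω)) P := by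
  refine Integrable.of_bound ((measurable_of_countable f).comp
    (measurable_visits (fun i _ => h i) x)).aestronglyMeasurable
    (∑ t ∈ Finset.range (N + 1), ‖f t‖) (ae_of_all _ fun ω => ?_)
  exact Finset.single_le_sum (f := fun t => ‖f t‖) (fun _ _ => norm_nonneg _)
    (Finset.mem_range.2 (Nat.lt_succ_of_le (visits_le ξ N x ω)))

/-- The law of an occupation count depends only on the law of the jumps. -/
lemma integral_comp_visits_eq {ξ ξ' : ℕ → Ω → Fin d → ℤ} (h : IsIIDJumps P μ ξ)
    (h' : IsIIDJumps P μ ξ') (N : ℕ) (x : Fin d → ℤ) (f : ℕ → ℝ) :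
    ∫ ω, f (visits ξ N x ω) ∂P = ∫ ω, f (visits ξ' N x ω) ∂P := by
  have : IsProbabilityMeasure μ := h.isProbabilityMeasure
  have key : ∀ ζ : ℕ → Ω → Fin d → ℤ, IsIIDJumps P μ ζ → ∫ ω, f (visits ζ N x ω) ∂P
      = ∫ s, f (visits (fun i (s : ℕ → Fin d → ℤ) => s i) N x s)
          ∂(Measure.infinitePi fun _ => μ) := by
    intro ζ hζ
    have h1 := (iIndepFun_iff_map_fun_eq_infinitePi_map fun i => hζ.meas i).1 hζ.indep
    simp_rw [hζ.law] at h1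
    rw [← h1, integral_map (measurable_pi_lambda _ hζ.meas).aemeasurable]
    · rfl
    · exact ((measurable_of_countable f).comp
        (measurable_visits (fun i _ => measurable_pi_apply i) x)).aestronglyMeasurable
  rw [key ξ h, key ξ' h']

lemma IsIIDJumps.integral_indicator_mul {ξ : ℕ → Ω → Fin d → ℤ} (h : IsIIDJumps P μ ξ) (m : ℕ)
    (u : Fin d → ℤ) {f : Ω → ℝ} (hf : Measurable[sigma ξ (Set.Ici m)] f) :
    ∫ ω, (if walk ξ m ω = u then 1 else 0) * f ω ∂P
      = (stepLaw μ m).real {u} * ∫ ω, f ω ∂P := by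
  have hle : sigma ξ (Set.Ici m) ≤ ‹MeasurableSpace Ω› :=
    iSup₂_le fun i _ => (h.meas i).comap_le
  have hm : ∀ {mΩ : MeasurableSpace Ω}, (∀ i < m, Measurable (ξ i)) →
      Measurable fun ω => (if walk ξ m ω = u then 1 else 0 : ℝ) := fun hξ =>
    Measurable.ite (measurable_walk hξ (measurableSet_singleton u)) measurable_const
      measurable_const
  have hi := h.indepFun_past_future m (hm (measurable_past ξ m)) hf
  have := hi.integral_mul_eq_mul_integral (hm fun i _ => h.meas i).aestronglyMeasurable
    (hf.mono hle le_rfl).aestronglyMeasurable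
  simp only [Pi.mul_apply] at this
  rw [this]
  congr 1
  have hs : MeasurableSet {ω | walk ξ m ω = u} :=
    measurable_walk (fun i _ => h.meas i) (measurableSet_singleton u)
  rw [measureReal_def, ← h.measure_walk_eq, ← measureReal_def, ← integral_indicator_one hs]
  refine integral_congr_ae (ae_of_all _ fun ω => ?_)
  simp [Set.indicator_apply]

/-- The moment recursion for the occupation count of the origin. -/
lemma integral_visits_pow_succ {ξ : ℕ → Ω → Fin d → ℤ} (h : IsIIDJumps P μ ξ) (N i : ℕ) :
    ∫ ω, (visits ξ N 0 ω : ℝ) ^ (i + 1) ∂P = ∑ m ∈ Finset.range N, (stepLaw μ m).real {0} *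
      ∫ ω, powDiff (i + 1) (visits ξ (N - m) 0 ω) ∂P := by
  simp_rw [visits_pow_eq]
  have hmeas : ∀ m, Measurable[IsIIDJumps.sigma ξ (Set.Ici m)]
      fun ω => powDiff (i + 1) (visits (shift m ξ) (N - m) 0 ω) := fun m =>
    (measurable_of_countable (powDiff (i + 1))).comp
      (measurable_visits (fun i _ => IsIIDJumps.measurable_future ξ m i) 0)
  rw [integral_finsetSum]
  · refine Finset.sum_congr rfl fun m _ => ?_
    rw [h.integral_indicator_mul m 0 (hmeas m), integral_comp_visits_eq (h.shift m) h]
  · intro m _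
    refine (integrable_comp_visits (P := P) (h.shift m).meas (N - m) 0
      (powDiff (i + 1))).bdd_mul (c := 1) ?_ (ae_of_all _ fun ω => ?_)
    · exact (Measurable.ite (measurable_walk (fun i _ => h.meas i) (measurableSet_singleton 0))
        measurable_const measurable_const).aestronglyMeasurable
    · split_ifs <;> simp

lemma integral_selfIntersection_eq {ξ : ℕ → Ω → Fin d → ℤ} (h : IsIIDJumps P μ ξ) (n i : ℕ) :
    ∫ ω, selfIntersection ξ n (i + 1) ω ∂P
      = ∑ N ∈ Finset.Ico 1 (n + 1), ∫ ω, powDiff (i + 1) (visits ξ N 0 ω) ∂P := by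
  simp_rw [selfIntersection_eq_sum_powDiff]
  rw [integral_finsetSum _ fun m _ => integrable_comp_visits (h.shift m).meas _ 0 _]
  refine Finset.sum_nbij' (fun m => n + 1 - m) (fun m => n + 1 - m) ?_ ?_ ?_ ?_ ?_
  · intro m hm; simp only [Finset.mem_Ico] at *; omega
  · intro m hm; simp only [Finset.mem_Ico] at *; omega
  · intro m hm; simp only [Finset.mem_Ico] at *; omega
  · intro m hm; simp only [Finset.mem_Ico] at *; omega
  · intro m _; exact integral_comp_visits_eq (h.shift m) h _ _ _

end Expectation

/-! ### Expectation asymptotics -/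

/-- A cutoff which is `o(n)` but has the same logarithm as `n` to leading order. -/
noncomputable def logCut (n : ℕ) : ℕ := ⌊(n : ℝ) / Real.log n⌋₊

lemma tendsto_log_natCast : Tendsto (fun n : ℕ => Real.log n) atTop atTop :=
  Real.tendsto_log_atTop.comp tendsto_natCast_atTop_atTop

lemma tendsto_log_div_self : Tendsto (fun n : ℕ => Real.log n / n) atTop (𝓝 0) :=
  (Real.isLittleO_log_id_atTop.tendsto_div_nhds_zero).comp tendsto_natCast_atTop_atTop

lemma tendsto_div_log_atTop : Tendsto (fun n : ℕ => (n : ℝ) / Real.log n) atTop atTop := by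
  have h1 : Tendsto (fun n : ℕ => Real.log n / n) atTop (𝓝[>] 0) := by
    refine tendsto_nhdsWithin_iff.2 ⟨tendsto_log_div_self, ?_⟩
    filter_upwards [eventually_ge_atTop 2] with n hn
    have : (1 : ℝ) < n := by exact_mod_cast hn
    exact div_pos (Real.log_pos this) (by linarith)
  refine (tendsto_inv_nhdsGT_zero.comp h1).congr fun n => ?_
  simp

lemma tendsto_logCut_atTop : Tendsto logCut atTop atTop :=
  tendsto_nat_floor_atTop.comp tendsto_div_log_atTop

lemma tendsto_logCut_div : Tendsto (fun n : ℕ => (logCut n : ℝ) / n) atTop (𝓝 0) := by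
  have h : Tendsto (fun n : ℕ => (Real.log n)⁻¹) atTop (𝓝 0) :=
    tendsto_inv_atTop_zero.comp tendsto_log_natCast
  refine tendsto_of_tendsto_of_tendsto_of_le_of_le' tendsto_const_nhds h
    (Eventually.of_forall fun n => by positivity) ?_
  filter_upwards [eventually_ge_atTop 2] with n hn
  have h1 : (1 : ℝ) < n := by exact_mod_cast hn
  have h2 := Real.log_pos h1
  rw [div_le_iff₀ (by linarith)]
  calc (logCut n : ℝ) ≤ n / Real.log n := Nat.floor_le (by positivity)
    _ = _ := by rw [div_eq_mul_inv, mul_comm]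

lemma tendsto_log_logCut_div :
    Tendsto (fun n : ℕ => Real.log (logCut n) / Real.log n) atTop (𝓝 1) := by
  have h1 : Tendsto (fun n : ℕ => 1 - (Real.log 2 / Real.log n +
      Real.log (Real.log n) / Real.log n)) atTop (𝓝 (1 - (0 + 0))) := by
    refine tendsto_const_nhds.sub (Tendsto.add ?_ ?_)
    · exact tendsto_const_nhds.div_atTop tendsto_log_natCast
    · exact (Real.isLittleO_log_id_atTop.tendsto_div_nhds_zero).comp tendsto_log_natCast
  rw [add_zero, sub_zero] at h1
  refine tendsto_of_tendsto_of_tendsto_of_le_of_le' h1 tendsto_const_nhds ?_ ?_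
  · filter_upwards [tendsto_log_natCast.eventually_gt_atTop 0,
      tendsto_div_log_atTop.eventually_ge_atTop 2, eventually_gt_atTop 0] with n h0 h2 hn
    have hn' : (0 : ℝ) < n := by exact_mod_cast hn
    rw [le_div_iff₀ h0]
    have h3 : (n : ℝ) / (2 * Real.log n) ≤ logCut n := by
      have h4 : (n : ℝ) / Real.log n - 1 < logCut n := Nat.sub_one_lt_floor _
      have h5 : (n : ℝ) / (2 * Real.log n) = (n / Real.log n) / 2 := by field_simp
      rw [h5]; linarith
    calc (1 - (Real.log 2 / Real.log n + Real.log (Real.log n) / Real.log n)) * Real.log n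
        = Real.log n - (Real.log 2 + Real.log (Real.log n)) := by field_simp
      _ = Real.log (n / (2 * Real.log n)) := by
          rw [Real.log_div hn'.ne' (by positivity), Real.log_mul (by norm_num) h0.ne']
      _ ≤ Real.log (logCut n) := Real.log_le_log (by positivity) h3
  · filter_upwards [eventually_ge_atTop 3, tendsto_logCut_atTop.eventually_gt_atTop 0] with n hn hc
    have hn' : (1 : ℝ) < n := by exact_mod_cast (by omega : 1 < n)
    have h0 := Real.log_pos hn'
    rw [div_le_one h0]
    refine Real.log_le_log (by exact_mod_cast hc) ?_
    refine (Nat.floor_le (by positivity)).trans (div_le_self (by positivity) ?_)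
    rw [Real.le_log_iff_exp_le (by linarith)]
    have : (3 : ℝ) ≤ n := by exact_mod_cast hn
    linarith [Real.exp_one_lt_d9]

/-- Asymptotics of `∑_{m < n} p_m b_{n-m}` when `b` is monotone and grows like a power of `log`. -/
lemma tendsto_sum_mul_div_log {p b : ℕ → ℝ} {κ c : ℝ} {i : ℕ} (hp : ∀ m, 0 ≤ p m)
    (hb : Monotone b) (hb0 : ∀ n, 0 ≤ b n)
    (hg : Tendsto (fun n : ℕ => (∑ m ∈ Finset.range n, p m) / Real.log n) atTop (𝓝 κ))
    (hbl : Tendsto (fun n : ℕ => b n / Real.log n ^ i) atTop (𝓝 c)) :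
    Tendsto (fun n : ℕ => (∑ m ∈ Finset.range n, p m * b (n - m)) / Real.log n ^ (i + 1)) atTop
      (𝓝 (κ * c)) := by
  -- lower bound: keep `m < logCut n`, where `n - m ≥ logCut n`
  have hlow : Tendsto (fun n : ℕ => ((∑ m ∈ Finset.range (logCut n), p m) / Real.log (logCut n)) *
      (b (logCut n) / Real.log (logCut n) ^ i) * (Real.log (logCut n) / Real.log n) ^ (i + 1)) atTop
      (𝓝 (κ * c * 1 ^ (i + 1))) :=
    ((hg.comp tendsto_logCut_atTop).mul (hbl.comp tendsto_logCut_atTop)).mul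
      (tendsto_log_logCut_div.pow (i + 1))
  rw [one_pow, mul_one] at hlow
  have hhalf : ∀ᶠ n : ℕ in atTop, 2 * logCut n ≤ n := by
    filter_upwards [tendsto_logCut_div.eventually_lt_const (show (0 : ℝ) < 1 / 2 by norm_num),
      eventually_gt_atTop 0] with n h hn
    have hn' : (0 : ℝ) < n := by exact_mod_cast hn
    rw [div_lt_iff₀ hn'] at h
    have : 2 * (logCut n : ℝ) ≤ n := by linarith
    exact_mod_cast this
  refine tendsto_of_tendsto_of_tendsto_of_le_of_le' hlow (hg.mul hbl) ?_ ?_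
  · filter_upwards [hhalf, tendsto_log_natCast.eventually_gt_atTop 0,
      (tendsto_log_natCast.comp tendsto_logCut_atTop).eventually_gt_atTop 0] with n h2 h0 hc0
    simp only [Function.comp] at hc0
    calc _ = (∑ m ∈ Finset.range (logCut n), p m * b (logCut n)) / Real.log n ^ (i + 1) := by
          rw [← Finset.sum_mul, div_pow]; field_simp; ring
      _ ≤ (∑ m ∈ Finset.range (logCut n), p m * b (n - m)) / Real.log n ^ (i + 1) := by
          gcongr with m hm
          · exact hp m
          · have : m < logCut n := by simpa using hm
            exact hb (by omega)
      _ ≤ _ := by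
          refine div_le_div_of_nonneg_right ?_ (by positivity)
          refine Finset.sum_le_sum_of_subset_of_nonneg (Finset.range_mono (by omega))
            fun m _ _ => mul_nonneg (hp m) (hb0 _)
  · filter_upwards [tendsto_log_natCast.eventually_gt_atTop 0] with n h0
    calc _ ≤ (∑ m ∈ Finset.range n, p m * b n) / Real.log n ^ (i + 1) := by
          gcongr with m hm
          · exact hp m
          · exact hb (Nat.sub_le _ _)
      _ = _ := by rw [← Finset.sum_mul, pow_succ]; field_simp

/-- Summation of a monotone sequence that grows like a power of `log`. -/
lemma tendsto_sum_div_mul_log {b : ℕ → ℝ} {c : ℝ} {i : ℕ} (hb : Monotone b) (hb0 : ∀ n, 0 ≤ b n)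
    (hbl : Tendsto (fun n : ℕ => b n / Real.log n ^ i) atTop (𝓝 c)) :
    Tendsto (fun n : ℕ => (∑ N ∈ Finset.Ico 1 (n + 1), b N) / (n * Real.log n ^ i)) atTop
      (𝓝 c) := by
  -- lower bound: keep the terms beyond `logCut n`
  have hlow : Tendsto (fun n : ℕ => (1 - (logCut n : ℝ) / n) *
      (b (logCut n) / Real.log (logCut n) ^ i) * (Real.log (logCut n) / Real.log n) ^ i) atTop
      (𝓝 ((1 - 0) * c * 1 ^ i)) :=
    ((tendsto_const_nhds.sub tendsto_logCut_div).mul (hbl.comp tendsto_logCut_atTop)).mul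
      (tendsto_log_logCut_div.pow i)
  rw [one_pow, mul_one, sub_zero, one_mul] at hlow
  refine tendsto_of_tendsto_of_tendsto_of_le_of_le' hlow hbl ?_ ?_
  · filter_upwards [tendsto_log_natCast.eventually_gt_atTop 0, eventually_gt_atTop 0,
      (tendsto_log_natCast.comp tendsto_logCut_atTop).eventually_gt_atTop 0,
      tendsto_logCut_div.eventually_lt_const (show (0 : ℝ) < 1 by norm_num)] with n h0 hn hc0 hc1
    simp only [Function.comp] at hc0
    have hn' : (0 : ℝ) < n := by exact_mod_cast hn
    have hle : logCut n ≤ n := by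
      rw [div_lt_one hn'] at hc1
      exact_mod_cast hc1.le
    calc _ = (∑ N ∈ Finset.Ico (logCut n + 1) (n + 1), b (logCut n)) / (n * Real.log n ^ i) := by
          rw [Finset.sum_const, Nat.card_Ico, nsmul_eq_mul,
            show n + 1 - (logCut n + 1) = n - logCut n by omega, Nat.cast_sub hle, div_pow]
          field_simp
      _ ≤ (∑ N ∈ Finset.Ico (logCut n + 1) (n + 1), b N) / (n * Real.log n ^ i) := by
          gcongr with N hN
          have := (Finset.mem_Ico.1 hN).1
          exact hb (by omega)
      _ ≤ _ := by
          refine div_le_div_of_nonneg_right ?_ (by positivity)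
          refine Finset.sum_le_sum_of_subset_of_nonneg
            (Finset.Ico_subset_Ico_left (by omega)) fun m _ _ => hb0 _
  · filter_upwards [tendsto_log_natCast.eventually_gt_atTop 0, eventually_gt_atTop 0] with n h0 hn
    have hn' : (0 : ℝ) < n := by exact_mod_cast hn
    calc _ ≤ (∑ N ∈ Finset.Ico 1 (n + 1), b n) / (n * Real.log n ^ i) := by
          gcongr with N hN
          have := (Finset.mem_Ico.1 hN).2
          exact hb (by omega)
      _ = _ := by
          rw [Finset.sum_const, Nat.card_Ico, nsmul_eq_mul, Nat.add_sub_cancel]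
          field_simp

section Expectation

variable [MeasurableSpace Ω] {P : Measure Ω} {μ : Measure (Fin d → ℤ)} [IsProbabilityMeasure P]

lemma monotone_integral_powDiff {ξ : ℕ → Ω → Fin d → ℤ} (h : IsIIDJumps P μ ξ) (i : ℕ) :
    Monotone fun N => ∫ ω, powDiff (i + 1) (visits ξ N 0 ω) ∂P := fun M N hMN =>
  integral_mono (integrable_comp_visits h.meas M 0 _) (integrable_comp_visits h.meas N 0 _)
    fun ω => powDiff_succ_mono i (visits_mono ξ hMN 0 ω)

lemma tendsto_integral_powDiff {ξ : ℕ → Ω → Fin d → ℤ} (h : IsIIDJumps P μ ξ) {κ : ℝ} {i : ℕ}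
    (hi : Tendsto (fun N : ℕ => (∫ ω, (visits ξ N 0 ω : ℝ) ^ i ∂P) / Real.log N ^ i) atTop
      (𝓝 (i.factorial * κ ^ i)))
    (hi' : Tendsto (fun N : ℕ => i * (∫ ω, (visits ξ N 0 ω : ℝ) ^ (i - 1) ∂P) / Real.log N ^ i)
      atTop (𝓝 0)) :
    Tendsto (fun N : ℕ => (∫ ω, powDiff (i + 1) (visits ξ N 0 ω) ∂P) / Real.log N ^ i) atTop
      (𝓝 ((i + 1).factorial * κ ^ i)) := by
  have e : ((i + 1).factorial : ℝ) * κ ^ i = (i + 1) * (i.factorial * κ ^ i) := by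
    rw [Nat.factorial_succ]; push_cast; ring
  have hint : ∀ N j, Integrable (fun ω => (visits ξ N 0 ω : ℝ) ^ j) P := fun N j =>
    integrable_comp_visits h.meas N 0 fun t => (t : ℝ) ^ j
  have hup := hi.const_mul ((i : ℝ) + 1)
  have hlow := (hi.sub hi').const_mul ((i : ℝ) + 1)
  rw [sub_zero] at hlow
  rw [e]
  refine tendsto_of_tendsto_of_tendsto_of_le_of_le' hlow hup ?_ ?_
  · filter_upwards [eventually_ge_atTop 1, tendsto_log_natCast.eventually_gt_atTop 0] with N hN h0
    rw [← sub_div, ← mul_div_assoc]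
    gcongr
    calc _ = ∫ ω, ((i : ℝ) + 1) * ((visits ξ N 0 ω : ℝ) ^ i
          - i * (visits ξ N 0 ω : ℝ) ^ (i - 1)) ∂P := by
          rw [integral_const_mul, integral_sub (hint N i) ((hint N (i - 1)).const_mul _),
            integral_const_mul]
      _ ≤ _ := integral_mono (((hint N i).sub ((hint N (i - 1)).const_mul _)).const_mul _)
          (integrable_comp_visits h.meas N 0 _)
          fun ω => le_powDiff_succ i (one_le_visits_zero ξ hN ω)
  · filter_upwards [eventually_ge_atTop 1, tendsto_log_natCast.eventually_gt_atTop 0] with N hN h0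
    rw [← mul_div_assoc]
    gcongr
    rw [← integral_const_mul]
    exact integral_mono (integrable_comp_visits h.meas N 0 _) ((hint N i).const_mul _)
      fun ω => powDiff_succ_le i (one_le_visits_zero ξ hN ω)

/-- The moments of the occupation count of the origin are asymptotically those of an exponential
variable with mean `κ log N`. -/
lemma tendsto_integral_visits_pow {ξ : ℕ → Ω → Fin d → ℤ} (h : IsIIDJumps P μ ξ) {κ : ℝ}
    (hg : Tendsto (fun n : ℕ => (∑ m ∈ Finset.range n, (stepLaw μ m).real {0}) / Real.log n)
      atTop (𝓝 κ)) (i : ℕ) :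
    Tendsto (fun N : ℕ => (∫ ω, (visits ξ N 0 ω : ℝ) ^ i ∂P) / Real.log N ^ i) atTop
      (𝓝 (i.factorial * κ ^ i)) ∧
    Tendsto (fun N : ℕ => (∫ ω, powDiff (i + 1) (visits ξ N 0 ω) ∂P) / Real.log N ^ i) atTop
      (𝓝 ((i + 1).factorial * κ ^ i)) := by
  induction i with
  | zero =>
    have h0 : Tendsto (fun N : ℕ => (∫ ω, (visits ξ N 0 ω : ℝ) ^ 0 ∂P) / Real.log N ^ 0) atTop
      (𝓝 ((0 : ℕ).factorial * κ ^ 0)) := by simp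
    exact ⟨h0, tendsto_integral_powDiff h h0 (by simp)⟩
  | succ i ih =>
    have h1 : Tendsto (fun N : ℕ => (∫ ω, (visits ξ N 0 ω : ℝ) ^ (i + 1) ∂P) /
        Real.log N ^ (i + 1)) atTop (𝓝 ((i + 1).factorial * κ ^ (i + 1))) := by
      have := tendsto_sum_mul_div_log (fun m => measureReal_nonneg)
        (monotone_integral_powDiff h i)
        (fun n => integral_nonneg fun ω => powDiff_succ_nonneg i _) hg ih.2
      rw [show ((i + 1).factorial : ℝ) * κ ^ (i + 1) = κ * ((i + 1).factorial * κ ^ i) by ring]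
      refine this.congr fun N => ?_
      rw [integral_visits_pow_succ h]
    refine ⟨h1, tendsto_integral_powDiff h h1 ?_⟩
    have h2 := (ih.1.mul (tendsto_inv_atTop_zero.comp tendsto_log_natCast)).const_mul
      ((i : ℝ) + 1)
    rw [mul_zero, mul_zero] at h2
    refine h2.congr fun N => ?_
    simp only [Function.comp, Nat.add_sub_cancel, pow_succ]
    push_cast
    rw [div_eq_mul_inv, div_eq_mul_inv, mul_inv]
    ring

/-- `E L_n(k) / (n (log n)^{k-1}) → k! κ^{k-1}`. -/
theorem tendsto_integral_selfIntersection {ξ : ℕ → Ω → Fin d → ℤ} (h : IsIIDJumps P μ ξ) {κ : ℝ}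
    (hg : Tendsto (fun n : ℕ => (∑ m ∈ Finset.range n, (stepLaw μ m).real {0}) / Real.log n)
      atTop (𝓝 κ)) (i : ℕ) :
    Tendsto (fun n : ℕ => (∫ ω, selfIntersection ξ n (i + 1) ω ∂P) / (n * Real.log n ^ i)) atTop
      (𝓝 ((i + 1).factorial * κ ^ i)) := by
  simp_rw [integral_selfIntersection_eq h]
  exact tendsto_sum_div_mul_log (monotone_integral_powDiff h i)
    (fun n => integral_nonneg fun ω => powDiff_succ_nonneg i _)
    (tendsto_integral_visits_pow h hg i).2

end Expectation

/-! ### Almost sure convergence -/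

/-- The subsequence `⌈exp(j^{2/3})⌉`: sparse enough for `∑ (log n_j)⁻²` to converge, dense enough
for `n_{j+1} / n_j → 1`. -/
noncomputable def sparseTime (j : ℕ) : ℕ := ⌈Real.exp ((j : ℝ) ^ (2 / 3 : ℝ))⌉₊

/-- The index `j` with `n_j ≤ n ≤ n_{j+1}`. -/
noncomputable def sparseIndex (n : ℕ) : ℕ := ⌊Real.log n ^ (3 / 2 : ℝ)⌋₊

lemma tendsto_rpow_natCast {a : ℝ} (ha : 0 < a) :
    Tendsto (fun j : ℕ => (j : ℝ) ^ a) atTop atTop :=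
  (tendsto_rpow_atTop ha).comp tendsto_natCast_atTop_atTop

lemma tendsto_sparseIndex : Tendsto sparseIndex atTop atTop :=
  tendsto_nat_floor_atTop.comp ((tendsto_rpow_atTop (by norm_num)).comp tendsto_log_natCast)

lemma tendsto_sparseTime : Tendsto sparseTime atTop atTop :=
  tendsto_nat_ceil_atTop.comp (Real.tendsto_exp_atTop.comp (tendsto_rpow_natCast (by norm_num)))

lemma sparseTime_sparseIndex_le {n : ℕ} (hn : 1 ≤ n) : sparseTime (sparseIndex n) ≤ n := by
  have hn' : (1 : ℝ) ≤ n := by exact_mod_cast hn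
  have hl := Real.log_nonneg hn'
  refine Nat.ceil_le.2 ?_
  calc Real.exp (((sparseIndex n : ℕ) : ℝ) ^ (2 / 3 : ℝ))
      ≤ Real.exp ((Real.log n ^ (3 / 2 : ℝ)) ^ (2 / 3 : ℝ)) := by
        gcongr
        exact Nat.floor_le (by positivity)
    _ = n := by
        rw [← Real.rpow_mul hl]
        norm_num
        exact Real.exp_log (by linarith)

lemma le_sparseTime_sparseIndex_succ {n : ℕ} (hn : 1 ≤ n) : n ≤ sparseTime (sparseIndex n + 1) := by
  have hn' : (1 : ℝ) ≤ n := by exact_mod_cast hn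
  have hl := Real.log_nonneg hn'
  have : (n : ℝ) ≤ Real.exp (((sparseIndex n + 1 : ℕ) : ℝ) ^ (2 / 3 : ℝ)) := by
    calc (n : ℝ) = Real.exp ((Real.log n ^ (3 / 2 : ℝ)) ^ (2 / 3 : ℝ)) := by
          rw [← Real.rpow_mul hl]
          norm_num
          exact (Real.exp_log (by linarith)).symm
      _ ≤ _ := by
          gcongr
          push_cast
          exact (Nat.lt_floor_add_one _).le
  exact_mod_cast this.trans (Nat.le_ceil _)

lemma rpow_le_log_sparseTime (j : ℕ) : (j : ℝ) ^ (2 / 3 : ℝ) ≤ Real.log (sparseTime j) := by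
  rw [Real.le_log_iff_exp_le (by
    have : 0 < sparseTime j := Nat.ceil_pos.2 (Real.exp_pos _)
    exact_mod_cast this)]
  exact Nat.le_ceil _

lemma tendsto_succ_rpow_sub :
    Tendsto (fun j : ℕ => ((j + 1 : ℕ) : ℝ) ^ (2 / 3 : ℝ) - (j : ℝ) ^ (2 / 3 : ℝ)) atTop (𝓝 0) := by
  have h1 : Tendsto (fun j : ℕ => (2 / 3 : ℝ) * (j : ℝ) ^ (-(1 / 3) : ℝ)) atTop (𝓝 ((2 / 3) * 0)) :=
    ((tendsto_rpow_neg_atTop (by norm_num)).comp tendsto_natCast_atTop_atTop).const_mul _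
  rw [mul_zero] at h1
  refine tendsto_of_tendsto_of_tendsto_of_le_of_le' tendsto_const_nhds h1 ?_ ?_
  · refine Eventually.of_forall fun j => sub_nonneg.2 ?_
    gcongr
    simp
  · filter_upwards [eventually_gt_atTop 0] with j hj
    have hj' : (0 : ℝ) < j := by exact_mod_cast hj
    have e1 : ((j + 1 : ℕ) : ℝ) = j * (1 + 1 / j) := by push_cast; field_simp
    have e2 : (j : ℝ) ^ (-(1 / 3) : ℝ) = (j : ℝ) ^ (2 / 3 : ℝ) * (1 / j) := by
      rw [show (-(1 / 3) : ℝ) = 2 / 3 - 1 by norm_num, Real.rpow_sub hj', Real.rpow_one]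
      ring
    rw [e1, Real.mul_rpow hj'.le (by positivity), e2]
    have := rpow_one_add_le_one_add_mul_self (s := 1 / (j : ℝ)) (p := 2 / 3)
      (by have : 0 ≤ 1 / (j : ℝ) := by positivity
          linarith) (by norm_num) (by norm_num)
    have hp : 0 ≤ (j : ℝ) ^ (2 / 3 : ℝ) := by positivity
    nlinarith

lemma tendsto_sparseTime_succ_div :
    Tendsto (fun j : ℕ => (sparseTime (j + 1) : ℝ) / sparseTime j) atTop (𝓝 1) := by
  have hexp : Tendsto (fun j : ℕ => Real.exp ((j : ℝ) ^ (2 / 3 : ℝ))) atTop atTop :=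
    Real.tendsto_exp_atTop.comp (tendsto_rpow_natCast (by norm_num))
  have h1 : Tendsto (fun j : ℕ => (sparseTime j : ℝ) / Real.exp ((j : ℝ) ^ (2 / 3 : ℝ))) atTop
      (𝓝 1) := (tendsto_nat_ceil_div_atTop (R := ℝ)).comp hexp
  have h2 : Tendsto (fun j : ℕ => Real.exp (((j + 1 : ℕ) : ℝ) ^ (2 / 3 : ℝ)
      - (j : ℝ) ^ (2 / 3 : ℝ))) atTop (𝓝 1) := by
    have := (Real.continuous_exp.tendsto 0).comp tendsto_succ_rpow_sub
    rwa [Real.exp_zero] at this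
  have h3 := ((h1.comp (tendsto_add_atTop_nat 1)).mul h2).div h1 one_ne_zero
  rw [mul_one, div_one] at h3
  refine h3.congr fun j => ?_
  simp only [Function.comp, Pi.div_apply]
  rw [Real.exp_sub]
  have := (Real.exp_pos ((j : ℝ) ^ (2 / 3 : ℝ))).ne'
  have := (Real.exp_pos (((j + 1 : ℕ) : ℝ) ^ (2 / 3 : ℝ))).ne'
  field_simp

lemma sparseTime_pos (j : ℕ) : (0 : ℝ) < sparseTime j := by
  have : 0 < sparseTime j := Nat.ceil_pos.2 (Real.exp_pos _)
  exact_mod_cast this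

lemma tendsto_log_sparseTime : Tendsto (fun j : ℕ => Real.log (sparseTime j)) atTop atTop :=
  tendsto_log_natCast.comp tendsto_sparseTime

lemma tendsto_norming_succ_div (i : ℕ) :
    Tendsto (fun j : ℕ => ((sparseTime (j + 1) : ℝ) * Real.log (sparseTime (j + 1)) ^ i) /
      (sparseTime j * Real.log (sparseTime j) ^ i)) atTop (𝓝 1) := by
  have hr := tendsto_sparseTime_succ_div
  have hl : Tendsto (fun j : ℕ => Real.log (sparseTime (j + 1)) / Real.log (sparseTime j)) atTop
      (𝓝 1) := by
    have h1 : Tendsto (fun j : ℕ => Real.log ((sparseTime (j + 1) : ℝ) / sparseTime j)) atTop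
        (𝓝 0) := by
      have := (Real.continuousAt_log one_ne_zero).tendsto.comp hr
      rwa [Real.log_one] at this
    have h2 := (h1.div_atTop tendsto_log_sparseTime).const_add 1
    rw [add_zero] at h2
    refine h2.congr' ?_
    filter_upwards [tendsto_log_sparseTime.eventually_gt_atTop 0] with j hj
    rw [Real.log_div (sparseTime_pos _).ne' (sparseTime_pos _).ne']
    field_simp
    ring
  have := hr.mul (hl.pow i)
  rw [one_pow, one_mul] at this
  refine this.congr fun j => ?_
  rw [div_pow, div_mul_div_comm]

/-- A nondecreasing sequence is controlled by its values along the sparse subsequence. -/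
lemma tendsto_div_of_tendsto_sparse {u : ℕ → ℝ} (hu : Monotone u) (hu0 : ∀ n, 0 ≤ u n) {c : ℝ}
    (i : ℕ)
    (h : Tendsto (fun j : ℕ => u (sparseTime j) / (sparseTime j * Real.log (sparseTime j) ^ i))
      atTop (𝓝 c)) :
    Tendsto (fun n : ℕ => u n / (n * Real.log n ^ i)) atTop (𝓝 c) := by
  set v : ℕ → ℝ := fun n => n * Real.log n ^ i with hv
  have hvmono : ∀ {m n : ℕ}, 1 ≤ m → m ≤ n → v m ≤ v n := by
    intro m n hm hmn
    have hm' : (1 : ℝ) ≤ m := by exact_mod_cast hm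
    have := Real.log_nonneg hm'
    simp only [hv]
    gcongr
  have hr := tendsto_norming_succ_div i
  have hup := ((h.comp (tendsto_add_atTop_nat 1)).mul hr).comp tendsto_sparseIndex
  have hlow := (h.div hr one_ne_zero).comp tendsto_sparseIndex
  rw [mul_one] at hup
  rw [div_one] at hlow
  have hvpos : ∀ᶠ j : ℕ in atTop, 0 < v (sparseTime j) := by
    filter_upwards [tendsto_log_sparseTime.eventually_gt_atTop 0] with j hj
    have := sparseTime_pos j
    simp only [hv]; positivity
  have hst : ∀ j, 1 ≤ sparseTime j := fun j => by exact_mod_cast sparseTime_pos j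
  refine tendsto_of_tendsto_of_tendsto_of_le_of_le' hlow hup ?_ ?_
  · filter_upwards [eventually_ge_atTop 1, tendsto_sparseIndex.eventually hvpos] with n hn hp
    have a1 := sparseTime_sparseIndex_le hn
    have a2 := le_sparseTime_sparseIndex_succ hn
    have b1 := hvmono (hst _) a1
    have b2 := hvmono hn a2
    simp only [Function.comp, Pi.div_apply]
    change u (sparseTime (sparseIndex n)) / v (sparseTime (sparseIndex n)) /
      (v (sparseTime (sparseIndex n + 1)) / v (sparseTime (sparseIndex n))) ≤ u n / v n
    rw [div_div_div_cancel_right₀ hp.ne']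
    exact div_le_div₀ (hu0 n) (hu a1) (hp.trans_le b1) b2
  · filter_upwards [eventually_ge_atTop 1, tendsto_sparseIndex.eventually hvpos] with n hn hp
    have a1 := sparseTime_sparseIndex_le hn
    have a2 := le_sparseTime_sparseIndex_succ hn
    have b1 := hvmono (hst _) a1
    have b2 := hvmono hn a2
    simp only [Function.comp]
    change u n / v n ≤ u (sparseTime (sparseIndex n + 1)) / v (sparseTime (sparseIndex n + 1)) *
      (v (sparseTime (sparseIndex n + 1)) / v (sparseTime (sparseIndex n)))
    rw [div_mul_div_cancel₀ (hp.trans_le (b1.trans b2)).ne']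
    exact div_le_div₀ (hu0 _) (hu a2) hp b1

lemma selfIntersection_mono (ξ : ℕ → Ω → Fin d → ℤ) {k : ℕ} (hk : 1 ≤ k) (ω : Ω) :
    Monotone fun n => selfIntersection ξ n k ω := by
  intro m n hmn
  refine Summable.tsum_le_tsum (fun x => ?_)
    (summable_of_hasFiniteSupport (finite_support_localTime_pow ξ m k hk ω))
    (summable_of_hasFiniteSupport (finite_support_localTime_pow ξ n k hk ω))
  gcongr
  exact Finset.sum_le_sum_of_subset (Finset.Icc_subset_Icc_right hmn)

section AlmostSure

variable [MeasurableSpace Ω] {P : Measure Ω} [IsProbabilityMeasure P]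

/-- Summable variances force centred variables to converge to `0` almost surely. -/
lemma ae_tendsto_zero_of_summable_variance {X : ℕ → Ω → ℝ} (hX : ∀ j, MemLp (X j) 2 P)
    (hsum : Summable fun j => Var[X j; P]) :
    ∀ᵐ ω ∂P, Tendsto (fun j => X j ω - ∫ ω', X j ω' ∂P) atTop (𝓝 0) := by
  have hfin : ∑' j, evariance (X j) P ≠ ⊤ := by
    simp_rw [fun j => ((hX j).ofReal_variance_eq).symm]
    exact hsum.tsum_ofReal_ne_top
  have hm : ∀ j, AEMeasurable (fun ω => ‖X j ω - ∫ ω', X j ω' ∂P‖ₑ ^ 2) P := fun j =>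
    (((hX j).aestronglyMeasurable.aemeasurable.sub_const _).enorm).pow_const 2
  have hfin' : ∫⁻ ω, ∑' j, ‖X j ω - ∫ ω', X j ω' ∂P‖ₑ ^ 2 ∂P ≠ ⊤ := by
    rw [lintegral_tsum hm]
    exact hfin
  filter_upwards [ae_lt_top' (AEMeasurable.tsum hm) hfin'] with ω hω
  have h0 := ENNReal.tendsto_atTop_zero_of_tsum_ne_top hω.ne
  have h1 : Tendsto (fun j => ‖X j ω - ∫ ω', X j ω' ∂P‖ ^ 2) atTop (𝓝 0) := by
    have := (ENNReal.tendsto_toReal ENNReal.zero_ne_top).comp h0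
    simpa [Function.comp_def] using this
  have h2 := (Real.continuous_sqrt.tendsto 0).comp h1
  rw [Real.sqrt_zero] at h2
  refine tendsto_zero_iff_norm_tendsto_zero.2 (h2.congr fun j => ?_)
  simp [Real.sqrt_sq_eq_abs]

/-- The strong law, from the asymptotics of the mean and the variance bound. -/
theorem ae_tendsto_selfIntersection {ξ : ℕ → Ω → Fin d → ℤ} (hmeas : ∀ i, Measurable (ξ i))
    {i : ℕ} {c : ℝ}
    (hE : Tendsto (fun n : ℕ => (∫ ω, selfIntersection ξ n (i + 1) ω ∂P) / (n * Real.log n ^ i))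
      atTop (𝓝 c))
    (hV : (fun n : ℕ => Var[selfIntersection ξ n (i + 1); P]) =O[atTop]
      fun n : ℕ => (n : ℝ) ^ 2 * Real.log n ^ (2 * (i : ℤ) - 2)) :
    ∀ᵐ ω ∂P, Tendsto (fun n : ℕ => selfIntersection ξ n (i + 1) ω / (n * Real.log n ^ i)) atTop
      (𝓝 c) := by
  set v : ℕ → ℝ := fun j => sparseTime j * Real.log (sparseTime j) ^ i with hv
  set X : ℕ → Ω → ℝ := fun j ω => (v j)⁻¹ * selfIntersection ξ (sparseTime j) (i + 1) ω with hX
  have hXL : ∀ j, MemLp (X j) 2 P := fun j =>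
    (memLp_selfIntersection hmeas (sparseTime j) (by omega) 2).const_mul _
  have hvar : ∀ j, Var[X j; P]
      = (v j)⁻¹ ^ 2 * Var[selfIntersection ξ (sparseTime j) (i + 1); P] := fun j =>
    variance_const_mul _ _ _
  have hsum : Summable fun j => Var[X j; P] := by
    have hs : Summable fun j : ℕ => 1 / (j : ℝ) ^ (4 / 3 : ℝ) :=
      Real.summable_one_div_nat_rpow.2 (by norm_num)
    refine summable_of_isBigO_nat hs ?_
    obtain ⟨K, hK⟩ := (hV.comp_tendsto tendsto_sparseTime).bound
    refine IsBigO.of_bound K ?_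
    filter_upwards [hK, tendsto_log_sparseTime.eventually_gt_atTop 0, eventually_gt_atTop 0]
      with j hj hl hj0
    have hj0' : (0 : ℝ) < j := by exact_mod_cast hj0
    have hs := sparseTime_pos j
    have hlj := rpow_le_log_sparseTime j
    simp only [Function.comp] at hj
    have hK0 : 0 ≤ K := by
      by_contra hneg
      have h1 : 0 < ‖(sparseTime j : ℝ) ^ 2 * Real.log (sparseTime j) ^ (2 * (i : ℤ) - 2)‖ := by
        rw [norm_pos_iff]; positivity
      have := (norm_nonneg _).trans hj
      nlinarith
    rw [Real.norm_of_nonneg (variance_nonneg _ _), Real.norm_of_nonneg (by positivity)] at hj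
    rw [Real.norm_of_nonneg (variance_nonneg _ _), Real.norm_of_nonneg (by positivity), hvar]
    calc _ ≤ (v j)⁻¹ ^ 2 * (K * ((sparseTime j : ℝ) ^ 2 *
          Real.log (sparseTime j) ^ (2 * (i : ℤ) - 2))) := by gcongr
      _ = K * (1 / Real.log (sparseTime j) ^ 2) := by
          have e : Real.log (sparseTime j) ^ (2 * (i : ℤ) - 2)
              = (Real.log (sparseTime j) ^ i) ^ 2 / Real.log (sparseTime j) ^ 2 := by
            rw [zpow_sub₀ hl.ne', ← pow_mul, mul_comm i 2]
            norm_cast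
          rw [e]
          simp only [hv]
          field_simp
      _ ≤ K * (1 / ((j : ℝ) ^ (2 / 3 : ℝ)) ^ 2) := by gcongr
      _ = _ := by
          rw [← Real.rpow_natCast, ← Real.rpow_mul hj0'.le]
          norm_num
  filter_upwards [ae_tendsto_zero_of_summable_variance hXL hsum] with ω hω
  refine tendsto_div_of_tendsto_sparse (u := fun n => selfIntersection ξ n (i + 1) ω)
    (selfIntersection_mono ξ (by omega) ω) (fun n => selfIntersection_nonneg _ _ _ _) i ?_
  have h1 := hω.add (hE.comp tendsto_sparseTime)
  rw [zero_add] at h1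
  refine h1.congr fun j => ?_
  simp only [hX, Function.comp, integral_const_mul, hv]
  ring

end AlmostSure

/-! ### From local asymptotics to the logarithmic growth of Green's function -/

lemma tendsto_harmonic_div_log :
    Tendsto (fun n : ℕ => (harmonic n : ℝ) / Real.log n) atTop (𝓝 1) := by
  have h1 : Tendsto (fun n : ℕ => 1 / Real.log n + 1) atTop (𝓝 (0 + 1)) :=
    (tendsto_const_nhds.div_atTop tendsto_log_natCast).add_const 1
  rw [zero_add] at h1
  refine tendsto_of_tendsto_of_tendsto_of_le_of_le' tendsto_const_nhds h1 ?_ ?_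
  · filter_upwards [tendsto_log_natCast.eventually_gt_atTop 0, eventually_gt_atTop 0] with n h0 hn
    rw [le_div_iff₀ h0, one_mul]
    refine le_trans (Real.log_le_log (by exact_mod_cast hn) ?_) (log_add_one_le_harmonic n)
    exact_mod_cast n.le_succ
  · filter_upwards [tendsto_log_natCast.eventually_gt_atTop 0] with n h0
    rw [div_le_iff₀ h0, add_mul, one_mul, div_mul_cancel₀ _ h0.ne']
    exact harmonic_le_one_add_log n

/-- If `(m + 1) p_m → κ`, then `∑_{m < n} p_m ~ κ log n`. -/
lemma tendsto_sum_range_div_log {p : ℕ → ℝ} {κ : ℝ}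
    (hp : Tendsto (fun m : ℕ => ((m : ℝ) + 1) * p m) atTop (𝓝 κ)) :
    Tendsto (fun n : ℕ => (∑ m ∈ Finset.range n, p m) / Real.log n) atTop (𝓝 κ) := by
  have hH : ∀ n : ℕ, (harmonic n : ℝ) = ∑ m ∈ Finset.range n, ((m : ℝ) + 1)⁻¹ := fun n => by
    simp [harmonic]
  have hHtop : Tendsto (fun n : ℕ => (harmonic n : ℝ)) atTop atTop := by
    refine tendsto_atTop_mono (fun n => log_add_one_le_harmonic n) ?_
    exact tendsto_log_natCast.comp (tendsto_add_atTop_nat 1)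
  have ho : (fun m : ℕ => p m - κ * ((m : ℝ) + 1)⁻¹) =o[atTop] fun m : ℕ => ((m : ℝ) + 1)⁻¹ := by
    refine (isLittleO_iff_tendsto' (Eventually.of_forall fun m h => ?_)).2 ?_
    · exact absurd h (by positivity)
    · have := hp.sub_const κ
      rw [sub_self] at this
      refine this.congr fun m => ?_
      have : (m : ℝ) + 1 ≠ 0 := by positivity
      field_simp
  have hs := ho.sum_range (fun m => by positivity) (by simpa only [← hH] using hHtop)
  simp only [Finset.sum_sub_distrib, ← Finset.mul_sum, ← hH] at hs
  have h1 := (hs.tendsto_div_nhds_zero.add_const κ).mul tendsto_harmonic_div_log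
  rw [zero_add, mul_one] at h1
  refine h1.congr' ?_
  filter_upwards [hHtop.eventually_gt_atTop 0] with n hn
  field_simp
  ring

/-! ### One-dimensional walks with a Cauchy-type characteristic function -/

section OneDim

variable {μ : Measure (Fin 1 → ℤ)}

/-- The characteristic function of a law on `ℤ`, as a function of a real variable. -/
noncomputable def phi (μ : Measure (Fin 1 → ℤ)) (t : ℝ) : ℂ :=
  ∫ x, Complex.exp ((t * x 0 : ℝ) * Complex.I) ∂μ

lemma charFn_toLp (μ : Measure (Fin 1 → ℤ)) (t : ℝ) :
    charFn μ (WithLp.toLp 2 fun _ => t) = phi μ t := by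
  simp only [charFn, phi, Finset.univ_unique, Finset.sum_singleton]
  congr 1
  ext x
  push_cast
  rw [mul_comm Complex.I]
  rfl

lemma integrable_exp_mul_I [IsFiniteMeasure μ] (f : (Fin 1 → ℤ) → ℝ) :
    Integrable (fun x => Complex.exp ((f x : ℝ) * Complex.I)) μ :=
  Integrable.of_bound (measurable_of_countable _).aestronglyMeasurable 1
    (ae_of_all _ fun x => by rw [Complex.norm_exp_ofReal_mul_I])

lemma continuous_phi [IsFiniteMeasure μ] : Continuous (phi μ) := by
  refine continuous_of_dominated (bound := fun _ => 1)
    (fun t => (measurable_of_countable _).aestronglyMeasurable)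
    (fun t => ae_of_all _ fun x => by rw [Complex.norm_exp_ofReal_mul_I])
    (integrable_const _) (ae_of_all _ fun x => by fun_prop)

lemma norm_phi_le [IsProbabilityMeasure μ] (t : ℝ) : ‖phi μ t‖ ≤ 1 := by
  refine (norm_integral_le_of_norm_le_const (C := 1)
    (ae_of_all _ fun x => by rw [Complex.norm_exp_ofReal_mul_I])).trans (by simp)

/-- Strong aperiodicity excludes `|φ(t)| = 1` inside a period, apart from `t = 0`. -/
lemma norm_phi_lt_one [IsProbabilityMeasure μ] (hs : StronglyAperiodic μ) {t : ℝ}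
    (ht : |t| ≤ Real.pi) (h0 : t ≠ 0) : ‖phi μ t‖ < 1 := by
  refine lt_of_le_of_ne (norm_phi_le t) fun hnorm => ?_
  set θ := (phi μ t).arg with hθ
  have hpolar : phi μ t = Complex.exp (θ * Complex.I) := by
    have := Complex.norm_mul_exp_arg_mul_I (phi μ t)
    rw [hnorm] at this
    simpa using this.symm
  -- rotating by `-θ`, the mean of `cos (t x - θ)` is `1`, so that `t x - θ ∈ 2πℤ` almost surely
  have hcos : ∫ x, Real.cos (t * x 0 - θ) ∂μ = 1 := by
    have h1 : ∫ x, Complex.exp ((t * x 0 - θ : ℝ) * Complex.I) ∂μ = 1 := by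
      have : ∀ x : Fin 1 → ℤ, Complex.exp ((t * x 0 - θ : ℝ) * Complex.I)
          = Complex.exp (-(θ * Complex.I)) * Complex.exp ((t * x 0 : ℝ) * Complex.I) := fun x => by
        rw [← Complex.exp_add]; congr 1; push_cast; ring
      simp_rw [this]
      rw [integral_const_mul]
      change _ * phi μ t = 1
      rw [hpolar, ← Complex.exp_add]
      simp
    have h2 := integral_re (𝕜 := ℂ) (integrable_exp_mul_I (μ := μ) fun x => t * x 0 - θ)
    rw [h1] at h2
    simp only [RCLike.re_to_complex, Complex.exp_ofReal_mul_I_re, Complex.one_re] at h2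
    exact h2
  have hint : Integrable (fun x : Fin 1 → ℤ => Real.cos (t * x 0 - θ)) μ :=
    Integrable.of_bound (measurable_of_countable _).aestronglyMeasurable 1
      (ae_of_all _ fun x => Real.abs_cos_le_one _)
  have hae : ∀ᵐ x ∂μ, Real.cos (t * x 0 - θ) = 1 := by
    have h1 : ∫ x, (1 - Real.cos (t * x 0 - θ)) ∂μ = 0 := by
      rw [integral_sub (integrable_const _) hint, hcos]; simp
    have h2 := (integral_eq_zero_iff_of_nonneg (fun x => sub_nonneg.2 (Real.cos_le_one _))
      ((integrable_const _).sub hint)).1 h1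
    filter_upwards [h2] with x hx
    simp only [Pi.zero_apply] at hx
    linarith
  obtain ⟨x₀, hx₀⟩ := hae.exists
  let L : AddSubgroup (Fin 1 → ℤ) :=
    { carrier := {y | ∃ n : ℤ, t * y 0 = n * (2 * Real.pi)}
      zero_mem' := ⟨0, by simp⟩
      add_mem' := by
        rintro a b ⟨m, hm⟩ ⟨n, hn⟩
        refine ⟨m + n, ?_⟩
        simp only [Pi.add_apply]
        push_cast
        rw [mul_add, hm, hn]; ring
      neg_mem' := by
        rintro a ⟨m, hm⟩
        refine ⟨-m, ?_⟩
        simp only [Pi.neg_apply]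
        push_cast
        rw [mul_neg, hm]; ring }
  have hL : L = ⊤ := by
    by_contra hL
    refine hs ⟨L, hL, x₀, ?_⟩
    have : ∀ᵐ y ∂μ, y - x₀ ∈ L := by
      filter_upwards [hae] with y hy
      obtain ⟨m, hm⟩ := (Real.cos_eq_one_iff _).1 hy
      obtain ⟨n, hn⟩ := (Real.cos_eq_one_iff _).1 hx₀
      refine ⟨m - n, ?_⟩
      simp only [Pi.sub_apply]
      push_cast
      rw [sub_mul, hm, hn]; ring
    exact (prob_compl_eq_zero_iff (Set.to_countable _).measurableSet).1 this
  obtain ⟨n, hn⟩ : (fun _ => 1 : Fin 1 → ℤ) ∈ L := hL ▸ AddSubgroup.mem_top _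
  have hn' : t = n * (2 * Real.pi) := by simpa using hn
  have hpi := Real.pi_pos
  rw [hn', abs_mul, abs_of_pos (show (0 : ℝ) < 2 * Real.pi by positivity)] at ht
  have hn0 : n ≠ 0 := by rintro rfl; simp at hn'; exact h0 hn'
  have : (1 : ℝ) ≤ |(n : ℝ)| := by exact_mod_cast Int.one_le_abs hn0
  nlinarith

/-- The expansion of the characteristic function at the origin, in a real variable. -/
lemma phi_expansion {γ : ℝ} (h : HasOneStableExpansion μ γ) :
    (fun t : ℝ => phi μ t - (1 - (γ : ℂ) * (|t| : ℝ))) =o[𝓝 0] fun t : ℝ => |t| := by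
  have hc : Tendsto (fun t : ℝ => (WithLp.toLp 2 fun _ => t : EuclideanSpace ℝ (Fin 1))) (𝓝 0)
      (𝓝 0) := by
    have : Continuous (fun t : ℝ => (WithLp.toLp 2 fun _ => t : EuclideanSpace ℝ (Fin 1))) := by
      fun_prop
    exact this.tendsto' 0 0 rfl
  have hn : ∀ t : ℝ, ‖(WithLp.toLp 2 fun _ => t : EuclideanSpace ℝ (Fin 1))‖ = |t| := fun t => by
    simp [EuclideanSpace.norm_eq, Real.sqrt_sq_eq_abs]
  have := h.2.comp_tendsto hc
  simpa only [Function.comp_def, charFn_toLp, hn] using this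

/-- Near `0` the expansion of `φ` gives the bound; away from `0`, strong aperiodicity and
compactness do. -/
lemma norm_phi_le_exp [IsProbabilityMeasure μ] (hs : StronglyAperiodic μ) {γ : ℝ}
    (h : HasOneStableExpansion μ γ) :
    ∃ c : ℝ, 0 < c ∧ ∀ t : ℝ, |t| ≤ Real.pi → ‖phi μ t‖ ≤ Real.exp (-c * |t|) := by
  have hγ := h.1
  have hpi := Real.pi_pos
  obtain ⟨δ₀, hδ₀, hball⟩ := Metric.eventually_nhds_iff.1
    ((phi_expansion h).bound (show 0 < γ / 2 by positivity))
  set δ := min (δ₀ / 2) (min 1 (1 / γ)) with hδ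
  have hδpos : 0 < δ := by positivity
  have hδ0 : δ < δ₀ := (min_le_left _ _).trans_lt (by linarith)
  have hδ1 : δ ≤ 1 := (min_le_right _ _).trans (min_le_left _ _)
  have hδγ : δ ≤ 1 / γ := (min_le_right _ _).trans (min_le_right _ _)
  have hnear : ∀ t : ℝ, |t| ≤ δ → ‖phi μ t‖ ≤ Real.exp (-(γ / 2) * |t|) := by
    intro t ht
    have h1 := hball (y := t) (by rw [dist_zero_right]; exact ht.trans_lt hδ0)
    rw [Real.norm_of_nonneg (abs_nonneg t)] at h1
    have h2 : ‖(1 - (γ : ℂ) * (|t| : ℝ))‖ = 1 - γ * |t| := by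
      have : (1 - (γ : ℂ) * (|t| : ℝ)) = ((1 - γ * |t| : ℝ) : ℂ) := by push_cast; ring
      rw [this, Complex.norm_real, Real.norm_of_nonneg]
      have : γ * |t| ≤ γ * (1 / γ) := by gcongr; exact ht.trans hδγ
      rw [mul_one_div_cancel hγ.ne'] at this
      linarith
    have h3 := norm_le_norm_sub_add (phi μ t) (1 - (γ : ℂ) * (|t| : ℝ))
    have h4 := Real.add_one_le_exp (-(γ / 2) * |t|)
    linarith
  have hK : IsCompact (Set.Icc (-Real.pi) Real.pi ∩ {t : ℝ | δ ≤ |t|}) :=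
    isCompact_Icc.inter_right (isClosed_le continuous_const continuous_abs)
  obtain ⟨t₀, ht₀, hmax⟩ := hK.exists_isMaxOn
    ⟨Real.pi, ⟨by linarith, le_rfl⟩, by
      simp only [Set.mem_ofPred_eq, abs_of_pos hpi]; linarith [Real.pi_gt_three]⟩
    (continuous_phi (μ := μ)).norm.continuousOn
  have hM : ‖phi μ t₀‖ < 1 := norm_phi_lt_one hs (abs_le.2 ht₀.1) fun h0 => by
    have := ht₀.2
    simp only [h0, Set.mem_ofPred_eq, abs_zero] at this
    linarith
  set M := ‖phi μ t₀‖ with hMdef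
  have hM' : 0 < 1 - M := by linarith
  refine ⟨min (γ / 2) ((1 - M) / Real.pi), by positivity, fun t ht => ?_⟩
  rcases le_total |t| δ with htδ | htδ
  · refine (hnear t htδ).trans ?_
    gcongr
    exact min_le_left _ _
  · have h1 : ‖phi μ t‖ ≤ M := hmax ⟨abs_le.1 ht, htδ⟩
    refine h1.trans ?_
    have h2 : min (γ / 2) ((1 - M) / Real.pi) * |t| ≤ (1 - M) / Real.pi * Real.pi := by
      gcongr
      exact min_le_right _ _
    rw [div_mul_cancel₀ _ hpi.ne'] at h2
    have h3 := Real.add_one_le_exp (-min (γ / 2) ((1 - M) / Real.pi) * |t|)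
    linarith

/-- The characteristic function of the walk after `m` steps. -/
lemma phi_stepLaw [IsProbabilityMeasure μ] (m : ℕ) (t : ℝ) : phi (stepLaw μ m) t = phi μ t ^ m := by
  induction m with
  | zero => simp [phi, stepLaw]
  | succ m ih =>
    have hint : Integrable (fun x : Fin 1 → ℤ => Complex.exp ((t * x 0 : ℝ) * Complex.I))
        (stepLaw μ m ∗ μ) := integrable_exp_mul_I _
    rw [phi, stepLaw, integral_conv hint, pow_succ, ← ih]
    have : ∀ x y : Fin 1 → ℤ, Complex.exp ((t * (x + y) 0 : ℝ) * Complex.I)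
        = Complex.exp ((t * x 0 : ℝ) * Complex.I) * Complex.exp ((t * y 0 : ℝ) * Complex.I) := by
      intro x y
      rw [← Complex.exp_add]; congr 1; simp; ring
    simp_rw [this, integral_const_mul, integral_mul_const]
    rfl

lemma integral_exp_int_mul_I (n : ℤ) :
    ∫ t in (-Real.pi)..Real.pi, Complex.exp ((t * n : ℝ) * Complex.I)
      = (if n = 0 then 2 * Real.pi else 0 : ℂ) := by
  split_ifs with h
  · subst h; simp; ring
  · have hc : (n : ℂ) * Complex.I ≠ 0 := by
      simp [h]
    have h1 : ∀ t : ℝ, Complex.exp ((t * n : ℝ) * Complex.I)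
        = Complex.exp ((n : ℂ) * Complex.I * t) := fun t => by
      congr 1; push_cast; ring
    simp_rw [h1]
    rw [integral_exp_mul_complex hc]
    have h2 : Complex.exp (n * Complex.I * (Real.pi : ℝ))
        = Complex.exp (n * Complex.I * (-Real.pi : ℝ)) := by
      rw [Complex.exp_eq_exp_iff_exists_int]
      exact ⟨n, by push_cast; ring⟩
    rw [h2, sub_self, zero_div]

/-- Fourier inversion on the lattice. -/
lemma stepLaw_singleton_eq_integral [IsProbabilityMeasure μ] (m : ℕ) (x : Fin 1 → ℤ) :
    (((stepLaw μ m).real {x} : ℝ) : ℂ) * (2 * Real.pi)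
      = ∫ t in (-Real.pi)..Real.pi, phi μ t ^ m * Complex.exp ((-t * x 0 : ℝ) * Complex.I) := by
  have hpi := Real.pi_pos
  have h1 : ∀ t : ℝ, phi μ t ^ m * Complex.exp ((-t * x 0 : ℝ) * Complex.I)
      = ∫ y, Complex.exp ((t * ((y 0 - x 0 : ℤ) : ℝ) : ℝ) * Complex.I) ∂(stepLaw μ m) := by
    intro t
    rw [← phi_stepLaw, phi, ← integral_mul_const]
    congr 1
    ext y
    rw [← Complex.exp_add]; congr 1; push_cast; ring
  simp_rw [h1]
  rw [intervalIntegral.integral_of_le (by linarith), integral_integral_swap]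
  · simp_rw [← intervalIntegral.integral_of_le (show -Real.pi ≤ Real.pi by linarith),
      integral_exp_int_mul_I]
    have h2 : ∀ y : Fin 1 → ℤ, (if y 0 - x 0 = 0 then (2 * Real.pi : ℂ) else 0)
        = Set.indicator {x} (fun _ => (2 * Real.pi : ℂ)) y := by
      intro y
      have : y 0 - x 0 = 0 ↔ y = x := by
        rw [sub_eq_zero]
        constructor
        · intro h; ext i; rw [Subsingleton.elim i 0, h]
        · rintro rfl; rfl
      simp [Set.indicator_apply, this]
    simp_rw [h2]
    rw [integral_indicator (measurableSet_singleton x), setIntegral_const]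
    simp
  · refine Integrable.of_bound (C := 1) ?_ (ae_of_all _ fun z => ?_)
    · refine Measurable.aestronglyMeasurable ?_
      refine measurable_from_prod_countable_left fun y => ?_
      fun_prop
    · simp only [Function.uncurry]
      rw [Complex.norm_exp_ofReal_mul_I]

lemma integral_exp_neg_mul_abs {c : ℝ} (hc : 0 < c) : ∫ s : ℝ, Real.exp (-c * |s|) = 2 / c := by
  rw [integral_comp_abs (f := fun s => Real.exp (-c * s)), integral_exp_mul_Ioi (by linarith)]
  simp
  ring

lemma integrable_exp_neg_mul_abs {c : ℝ} (hc : 0 < c) :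
    Integrable fun s : ℝ => Real.exp (-c * |s|) := by
  by_contra h
  have h1 := integral_exp_neg_mul_abs hc
  rw [integral_undef h] at h1
  have : 0 < 2 / c := by positivity
  linarith

/-- The integrand of Fourier inversion after the substitution `t = s / m`, extended by zero to the
whole line so that dominated convergence applies. -/
noncomputable def rescaled (μ : Measure (Fin 1 → ℤ)) (x : Fin 1 → ℤ) (m : ℕ) (s : ℝ) : ℂ :=
  Set.indicator (Set.Ioc (-(Real.pi * m)) (Real.pi * m))
    (fun s => phi μ (s / m) ^ m * Complex.exp ((-(s / m) * x 0 : ℝ) * Complex.I)) s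

lemma mul_stepLaw_singleton_eq_integral [IsProbabilityMeasure μ] {m : ℕ} (hm : 1 ≤ m)
    (x : Fin 1 → ℤ) :
    ((m * (stepLaw μ m).real {x} : ℝ) : ℂ) * (2 * Real.pi) = ∫ s, rescaled μ x m s := by
  have hm0 : (m : ℝ) ≠ 0 := by positivity
  have hpi := Real.pi_pos
  have h := intervalIntegral.integral_comp_div (a := -(Real.pi * m)) (b := Real.pi * m)
    (fun t => phi μ t ^ m * Complex.exp ((-t * x 0 : ℝ) * Complex.I)) hm0
  rw [neg_div, mul_div_cancel_right₀ _ hm0, ← stepLaw_singleton_eq_integral] at h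
  simp only [rescaled]
  rw [integral_indicator measurableSet_Ioc, ← intervalIntegral.integral_of_le (by
    have : 0 ≤ Real.pi * m := by positivity
    linarith), h]
  rw [Complex.real_smul]
  push_cast
  ring

lemma norm_rescaled_le {c : ℝ} (hc : ∀ t : ℝ, |t| ≤ Real.pi → ‖phi μ t‖ ≤ Real.exp (-c * |t|))
    (x : Fin 1 → ℤ) {m : ℕ} (hm : 1 ≤ m) (s : ℝ) : ‖rescaled μ x m s‖ ≤ Real.exp (-c * |s|) := by
  have hm0 : (0 : ℝ) < m := by exact_mod_cast hm
  simp only [rescaled, Set.indicator_apply]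
  split_ifs with h
  · rw [norm_mul, Complex.norm_exp_ofReal_mul_I, mul_one, norm_pow]
    have hs : |s / m| ≤ Real.pi := by
      rw [abs_div, abs_of_pos hm0, div_le_iff₀ hm0]
      exact abs_le.2 ⟨h.1.le, h.2⟩
    calc ‖phi μ (s / m)‖ ^ m ≤ Real.exp (-c * |s / m|) ^ m := by gcongr; exact hc _ hs
      _ = Real.exp (-c * |s|) := by
          rw [← Real.exp_nat_mul, abs_div, abs_of_pos hm0]
          congr 1
          field_simp
  · rw [norm_zero]; positivity

/-- The uniform local bound for Cauchy-type walks. -/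
lemma uniformLocalBound_of_phi_le [IsProbabilityMeasure μ] {c : ℝ} (hc0 : 0 < c)
    (hc : ∀ t : ℝ, |t| ≤ Real.pi → ‖phi μ t‖ ≤ Real.exp (-c * |t|)) :
    ∃ C : ℝ≥0, UniformLocalBound μ C := by
  have hpi := Real.pi_pos
  refine ⟨(1 + 1 / c).toNNReal, fun m x => ?_⟩
  have key : (stepLaw μ m).real {x} ≤ (1 + 1 / c) / (m + 1 : ℕ) := by
    rw [le_div_iff₀ (by positivity)]
    have h1 : (stepLaw μ m).real {x} ≤ 1 := measureReal_le_one
    have h2 : m * (stepLaw μ m).real {x} ≤ 1 / c := by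
      rcases Nat.eq_zero_or_pos m with rfl | hm
      · simp; positivity
      · have h3 := norm_integral_le_of_norm_le (integrable_exp_neg_mul_abs hc0)
          (ae_of_all _ (norm_rescaled_le hc x hm))
        rw [← mul_stepLaw_singleton_eq_integral hm, integral_exp_neg_mul_abs hc0, norm_mul,
          Complex.norm_real, Real.norm_of_nonneg (by positivity)] at h3
        have h4 : ‖(2 * Real.pi : ℂ)‖ = 2 * Real.pi := by
          rw [norm_mul, Complex.norm_real, Real.norm_of_nonneg hpi.le]; simp
        rw [h4] at h3
        have h5 : 0 ≤ m * (stepLaw μ m).real {x} := by positivity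
        have h6 : 2 / c = 2 * (1 / c) := by ring
        rw [h6] at h3
        nlinarith [Real.pi_gt_three]
    push_cast
    linarith
  rw [← ofReal_measureReal, ← ENNReal.ofReal, ← ENNReal.ofReal_natCast,
    ← ENNReal.ofReal_div_of_pos (by positivity)]
  exact ENNReal.ofReal_le_ofReal key

/-- The local limit theorem at the origin: `m P(S(m) = 0) → 1/(πγ)`. -/
lemma tendsto_mul_stepLaw_zero [IsProbabilityMeasure μ] (hs : StronglyAperiodic μ) {γ : ℝ}
    (h : HasOneStableExpansion μ γ) :
    Tendsto (fun m : ℕ => (m : ℝ) * (stepLaw μ m).real {0}) atTop (𝓝 (1 / (Real.pi * γ))) := by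
  have hpi := Real.pi_pos
  have hγ := h.1
  obtain ⟨c, hc0, hc⟩ := norm_phi_le_exp hs h
  have hlim : Tendsto (fun m : ℕ => ∫ s, rescaled μ 0 m s) atTop
      (𝓝 (∫ s : ℝ, ((Real.exp (-γ * |s|) : ℝ) : ℂ))) := by
    have hmeas : ∀ m, AEStronglyMeasurable (rescaled μ 0 m) := fun m => by
      have : Continuous fun s : ℝ => phi μ (s / m) ^ m *
          Complex.exp ((-(s / m) * (0 : Fin 1 → ℤ) 0 : ℝ) * Complex.I) :=
        ((continuous_phi.comp (continuous_id.div_const _)).pow m).mul (by fun_prop)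
      exact (this.measurable.indicator measurableSet_Ioc).aestronglyMeasurable
    refine tendsto_integral_filter_of_dominated_convergence _ (Eventually.of_forall hmeas)
      (by filter_upwards [eventually_ge_atTop 1] with m hm
          exact ae_of_all _ (norm_rescaled_le hc 0 hm)) (integrable_exp_neg_mul_abs hc0)
      (ae_of_all _ fun s => ?_)
    have hdiv : Tendsto (fun m : ℕ => s / (m : ℝ)) atTop (𝓝 0) :=
      tendsto_const_nhds.div_atTop tendsto_natCast_atTop_atTop
    have herr : Tendsto (fun m : ℕ => (m : ℂ) *
        (phi μ (s / m) - (1 - (γ : ℂ) * (|s / m| : ℝ)))) atTop (𝓝 0) := by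
      have h1 := (phi_expansion h).comp_tendsto hdiv
      have h2 : (fun m : ℕ => |s / (m : ℝ)|) =O[atTop] fun m : ℕ => (m : ℝ)⁻¹ := by
        refine IsBigO.of_bound |s| (Eventually.of_forall fun m => ?_)
        rw [Real.norm_of_nonneg (abs_nonneg _), Real.norm_of_nonneg (by positivity), abs_div,
          Nat.abs_cast, div_eq_mul_inv]
      have h3 := (h1.trans_isBigO h2).norm_left.tendsto_div_nhds_zero
      refine tendsto_zero_iff_norm_tendsto_zero.2 (h3.congr fun m => ?_)
      simp only [Function.comp, div_inv_eq_mul, norm_mul, Complex.norm_natCast]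
      ring
    have hexp : Tendsto (fun m : ℕ => (m : ℂ) * (phi μ (s / m) - 1)) atTop
        (𝓝 ((-γ * |s| : ℝ) : ℂ)) := by
      have h1 := herr.sub_const ((γ * |s| : ℝ) : ℂ)
      rw [zero_sub] at h1
      have h2 : ((-γ * |s| : ℝ) : ℂ) = -((γ * |s| : ℝ) : ℂ) := by push_cast; ring
      rw [h2]
      refine h1.congr' ?_
      filter_upwards [eventually_gt_atTop 0] with m hm
      have hm0 : (m : ℂ) ≠ 0 := by exact_mod_cast hm.ne'
      rw [abs_div, Nat.abs_cast]
      push_cast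
      field_simp
      ring
    have hpow := Complex.tendsto_one_add_pow_exp_of_tendsto hexp
    rw [Complex.ofReal_exp]
    refine hpow.congr' ?_
    have hlarge : ∀ᶠ m : ℕ in atTop, |s| < Real.pi * m :=
      (tendsto_natCast_atTop_atTop.const_mul_atTop hpi).eventually_gt_atTop _
    filter_upwards [hlarge] with m hm
    have hmem : s ∈ Set.Ioc (-(Real.pi * m)) (Real.pi * m) :=
      ⟨(abs_lt.1 hm).1, (abs_lt.1 hm).2.le⟩
    simp [rescaled, Set.indicator_of_mem hmem]
  rw [integral_complex_ofReal, integral_exp_neg_mul_abs hγ] at hlim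
  have h1 : Tendsto (fun m : ℕ => (((m * (stepLaw μ m).real {0} : ℝ) : ℂ) * (2 * Real.pi)))
      atTop (𝓝 ((2 / γ : ℝ) : ℂ)) := by
    refine hlim.congr' ?_
    filter_upwards [eventually_ge_atTop 1] with m hm
    exact (mul_stepLaw_singleton_eq_integral hm 0).symm
  have h2 := (Complex.continuous_re.tendsto _).comp h1
  have h3 : Tendsto (fun m : ℕ => (m * (stepLaw μ m).real {0}) * (2 * Real.pi)) atTop
      (𝓝 (2 / γ)) := by
    refine (h2.congr fun m => ?_)
    have : (((m * (stepLaw μ m).real {0} : ℝ) : ℂ) * (2 * Real.pi))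
        = ((m * (stepLaw μ m).real {0} * (2 * Real.pi) : ℝ) : ℂ) := by push_cast; ring
    simp only [Function.comp]
    rw [this, Complex.ofReal_re]
  have h4 := h3.div_const (2 * Real.pi)
  have e : 2 / γ / (2 * Real.pi) = 1 / (Real.pi * γ) := by field_simp
  rw [e] at h4
  refine h4.congr fun m => ?_
  rw [mul_div_cancel_right₀ _ (by positivity)]

lemma tendsto_green_of_expansion [IsProbabilityMeasure μ] (hs : StronglyAperiodic μ) {γ : ℝ}
    (h : HasOneStableExpansion μ γ) :
    Tendsto (fun n : ℕ => (∑ m ∈ Finset.range n, (stepLaw μ m).real {0}) / Real.log n) atTop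
      (𝓝 (1 / (Real.pi * γ))) := by
  refine tendsto_sum_range_div_log ?_
  have h1 := tendsto_mul_stepLaw_zero hs h
  have h2 : Tendsto (fun m : ℕ => ((m : ℝ) + 1) / m) atTop (𝓝 1) := by
    have := (tendsto_one_div_atTop_nhds_zero_nat (𝕜 := ℝ)).const_add 1
    rw [add_zero] at this
    refine this.congr' ?_
    filter_upwards [eventually_gt_atTop 0] with m hm
    have : (m : ℝ) ≠ 0 := by positivity
    field_simp
  have h3 := h2.mul h1
  rw [one_mul] at h3
  refine h3.congr' ?_
  filter_upwards [eventually_gt_atTop 0] with m hm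
  have : (m : ℝ) ≠ 0 := by positivity
  field_simp

end OneDim

/-! ### Planar simple random walk -/

/-- Transition probabilities of the simple random walk on `ℤ` started at `0`. -/
noncomputable def simpleProb : ℕ → ℤ → ℝ
  | 0, y => if y = 0 then 1 else 0
  | m + 1, y => (simpleProb m (y - 1) + simpleProb m (y + 1)) / 2

lemma simpleProb_nonneg (m : ℕ) (y : ℤ) : 0 ≤ simpleProb m y := by
  induction m generalizing y with
  | zero => simp only [simpleProb]; split_ifs <;> norm_num
  | succ m ih => simp only [simpleProb]; linarith [ih (y - 1), ih (y + 1)]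

lemma simpleProb_eq_zero_of_lt (m : ℕ) (y : ℤ) (hy : (m : ℤ) < |y|) : simpleProb m y = 0 := by
  induction m generalizing y with
  | zero => simp only [simpleProb]; rw [if_neg]; rintro rfl; simp at hy
  | succ m ih =>
    push_cast at hy
    simp only [simpleProb]
    rw [ih _ (by rcases abs_cases y with h | h <;> rcases abs_cases (y - 1) with h' | h' <;> omega),
      ih _ (by rcases abs_cases y with h | h <;> rcases abs_cases (y + 1) with h' | h' <;> omega)]
    simp

lemma simpleProb_eq_zero_of_odd (m : ℕ) (y : ℤ) (hy : Odd (m + y)) : simpleProb m y = 0 := by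
  induction m generalizing y with
  | zero => simp only [simpleProb]; rw [if_neg]; rintro rfl; simp at hy
  | succ m ih =>
    simp only [simpleProb]
    obtain ⟨c, hc⟩ := hy
    push_cast at hc
    rw [ih _ ⟨c - 1, by omega⟩, ih _ ⟨c, by omega⟩]
    simp

lemma simpleProb_eq_choose (m i : ℕ) : simpleProb m (2 * i - m) = m.choose i / 2 ^ m := by
  induction m generalizing i with
  | zero =>
    rcases i with _ | i
    · simp [simpleProb]
    · simp only [simpleProb]
      rw [if_neg (by push_cast; omega)]
      simp
  | succ m ih =>
    have h1 : (2 * (i : ℤ) - (m + 1 : ℕ) + 1) = 2 * i - m := by push_cast; ring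
    simp only [simpleProb]
    rw [h1, ih]
    rcases i with _ | i
    · rw [simpleProb_eq_zero_of_lt]
      · simp [pow_succ]; ring
      · push_cast; rw [abs_of_neg (by omega)]; omega
    · have h2 : (2 * ((i + 1 : ℕ) : ℤ) - (m + 1 : ℕ) - 1) = 2 * i - m := by push_cast; ring
      rw [h2, ih, Nat.choose_succ_succ]
      push_cast
      rw [pow_succ]
      field_simp

/-- The return probabilities are inverse Wallis products. -/
lemma simpleProb_two_mul_zero_sq (n : ℕ) :
    simpleProb (2 * n) 0 ^ 2 = 1 / ((2 * n + 1) * Real.Wallis.W n) := by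
  have h1 := simpleProb_eq_choose (2 * n) n
  have h0 : (2 * (n : ℤ) - (2 * n : ℕ)) = 0 := by push_cast; ring
  rw [h0] at h1
  have h2 : ((2 * n).choose n : ℝ) * n.factorial * n.factorial = (2 * n).factorial := by
    have := Nat.choose_mul_factorial_mul_factorial (show n ≤ 2 * n by omega)
    rw [show 2 * n - n = n by omega] at this
    exact_mod_cast this
  have hn : (n.factorial : ℝ) ≠ 0 := by exact_mod_cast n.factorial_ne_zero
  have h2n : ((2 * n).factorial : ℝ) ≠ 0 := by exact_mod_cast (2 * n).factorial_ne_zero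
  have h3 : ((2 * n).choose n : ℝ) = (2 * n).factorial / n.factorial ^ 2 := by
    rw [← h2]; field_simp
  rw [h1, h3, Real.Wallis.W_eq_factorial_ratio, show 4 * n = 2 * n + 2 * n by ring, pow_add]
  have : (2 * (n : ℝ) + 1) ≠ 0 := by positivity
  field_simp

lemma simpleProb_two_mul_le (n : ℕ) (y : ℤ) : simpleProb (2 * n) y ≤ simpleProb (2 * n) 0 := by
  by_cases hodd : Odd (((2 * n : ℕ) : ℤ) + y)
  · rw [simpleProb_eq_zero_of_odd _ _ hodd]; exact simpleProb_nonneg _ _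
  by_cases hlt : ((2 * n : ℕ) : ℤ) < |y|
  · rw [simpleProb_eq_zero_of_lt _ _ hlt]; exact simpleProb_nonneg _ _
  obtain ⟨c, hc⟩ := Int.not_odd_iff_even.1 hodd
  have hc0 : 0 ≤ c := by
    rcases abs_cases y with h | h <;> omega
  lift c to ℕ using hc0
  have hy : y = 2 * (c : ℤ) - (2 * n : ℕ) := by omega
  have h0 : (0 : ℤ) = 2 * (n : ℤ) - (2 * n : ℕ) := by push_cast; ring
  rw [hy, simpleProb_eq_choose]
  conv_rhs => rw [h0, simpleProb_eq_choose]
  gcongr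
  have := Nat.choose_le_middle c (2 * n)
  rwa [show 2 * n / 2 = n by omega] at this

lemma simpleProb_sq_le (m : ℕ) (y : ℤ) : simpleProb m y ^ 2 ≤ 4 / (m + 1) := by
  have heven : ∀ (n : ℕ) (y : ℤ), simpleProb (2 * n) y ^ 2 ≤ (4 / 3) / (2 * n + 1) := by
    intro n y
    have hW : 3 / 4 ≤ Real.Wallis.W n := by
      refine le_trans ?_ (Real.Wallis.le_W n)
      have h1 : (1 / 2 : ℝ) ≤ (2 * n + 1) / (2 * n + 2) := by
        rw [le_div_iff₀ (by positivity)]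
        have : (0 : ℝ) ≤ n := by positivity
        linarith
      nlinarith [Real.pi_gt_three]
    calc simpleProb (2 * n) y ^ 2 ≤ simpleProb (2 * n) 0 ^ 2 :=
          pow_le_pow_left₀ (simpleProb_nonneg _ _) (simpleProb_two_mul_le n y) 2
      _ = 1 / ((2 * n + 1) * Real.Wallis.W n) := simpleProb_two_mul_zero_sq n
      _ ≤ 1 / ((2 * n + 1) * (3 / 4)) := by gcongr
      _ = _ := by field_simp
  rcases Nat.even_or_odd' m with ⟨n, rfl | rfl⟩
  · refine (heven n y).trans ?_
    push_cast
    gcongr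
    norm_num
  · have h1 := heven n (y - 1)
    have h2 := heven n (y + 1)
    have h3 : simpleProb (2 * n + 1) y ^ 2
        ≤ (simpleProb (2 * n) (y - 1) ^ 2 + simpleProb (2 * n) (y + 1) ^ 2) / 2 := by
      simp only [simpleProb]
      nlinarith [sq_nonneg (simpleProb (2 * n) (y - 1) - simpleProb (2 * n) (y + 1))]
    have h4 : (4 / 3 : ℝ) / (2 * n + 1) ≤ 4 / ((2 * n + 1 : ℕ) + 1) := by
      push_cast
      rw [div_le_div_iff₀ (by positivity) (by positivity)]
      have : (0 : ℝ) ≤ n := by positivity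
      linarith
    linarith

section Planar

variable {μ : Measure (Fin 2 → ℤ)}

/-- The law of a simple jump is the uniform law on the four unit vectors. -/
lemma IsSimpleJump.eq_sum_dirac [IsProbabilityMeasure μ] (h : IsSimpleJump μ) :
    μ = (1 / 4 : ℝ≥0∞) • (Measure.dirac ![1, 0] + Measure.dirac ![-1, 0] +
      Measure.dirac ![0, 1] + Measure.dirac ![0, -1]) := by
  set E : Finset (Fin 2 → ℤ) := {![1, 0], ![-1, 0], ![0, 1], ![0, -1]} with hE
  have hmem : ∀ e ∈ E, μ {e} = 1 / 4 := by
    intro e he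
    apply h
    simp only [hE, Finset.mem_insert, Finset.mem_singleton] at he
    rcases he with rfl | rfl | rfl | rfl <;> simp
  have hcard : E.card = 4 := by decide
  have hE1 : μ E = 1 := by
    rw [← sum_measure_singleton, Finset.sum_congr rfl hmem, Finset.sum_const, hcard]
    simp only [nsmul_eq_mul, one_div]
    exact ENNReal.mul_inv_cancel (by simp) (by simp)
  have hE0 : μ (E : Set (Fin 2 → ℤ))ᶜ = 0 :=
    (prob_compl_eq_zero_iff (Set.to_countable _).measurableSet).2 hE1
  refine Measure.ext_of_singleton fun x => ?_
  by_cases hx : x ∈ E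
  · rw [hmem x hx]
    simp only [hE, Finset.mem_insert, Finset.mem_singleton] at hx
    rcases hx with rfl | rfl | rfl | rfl <;> simp
  · have h0 : μ {x} = 0 := measure_mono_null (by simpa using hx) hE0
    rw [h0]
    simp only [hE, Finset.mem_insert, Finset.mem_singleton, not_or] at hx
    obtain ⟨h1, h2, h3, h4⟩ := hx
    simp [Ne.symm h1, Ne.symm h2, Ne.symm h3, Ne.symm h4]

lemma IsSimpleJump.integral_eq [IsProbabilityMeasure μ] (h : IsSimpleJump μ)
    (f : (Fin 2 → ℤ) → ℝ) :
    ∫ x, f x ∂μ = (f ![1, 0] + f ![-1, 0] + f ![0, 1] + f ![0, -1]) / 4 := by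
  have hi : ∀ a : Fin 2 → ℤ, Integrable f (Measure.dirac a) := fun a =>
    integrable_dirac (by simp)
  rw [h.eq_sum_dirac, integral_smul_measure, integral_add_measure (((hi _).add_measure
    (hi _)).add_measure (hi _)) (hi _), integral_add_measure ((hi _).add_measure (hi _)) (hi _),
    integral_add_measure (hi _) (hi _)]
  simp only [integral_dirac, smul_eq_mul]
  norm_num
  ring

lemma IsSimpleJump.covMatrix_det [IsProbabilityMeasure μ] (h : IsSimpleJump μ) :
    2 * √(covMatrix μ).det = 1 := by
  have h1 : (covMatrix μ).det = (1 / 2) ^ 2 := by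
    rw [Matrix.det_fin_two]
    simp only [covMatrix, Matrix.of_apply, covariance, h.integral_eq]
    norm_num
  rw [h1, Real.sqrt_sq (by norm_num)]
  norm_num

lemma stepLaw_succ_singleton [IsProbabilityMeasure μ] (h : IsSimpleJump μ) (m : ℕ)
    (x : Fin 2 → ℤ) :
    (stepLaw μ (m + 1)).real {x} = ((stepLaw μ m).real {x - ![1, 0]} +
      (stepLaw μ m).real {x - ![-1, 0]} + (stepLaw μ m).real {x - ![0, 1]} +
      (stepLaw μ m).real {x - ![0, -1]}) / 4 := by
  rw [← h.integral_eq fun e => (stepLaw μ m).real {x - e}]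
  have h1 : stepLaw μ (m + 1) {x} = ∫⁻ e, stepLaw μ m {x - e} ∂μ := by
    rw [stepLaw, Measure.conv_comm, ← lintegral_indicator_one (measurableSet_singleton x),
      Measure.lintegral_conv (measurable_of_countable _)]
    refine lintegral_congr fun e => ?_
    rw [← lintegral_indicator_one (measurableSet_singleton _)]
    refine lintegral_congr fun y => ?_
    have : e + y = x ↔ y = x - e := by rw [eq_sub_iff_add_eq, add_comm]
    simp [Set.indicator_apply, this]
  rw [measureReal_def, h1, ← integral_toReal (measurable_of_countable _).aemeasurable
    (ae_of_all _ fun e => measure_lt_top _ _)]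
  rfl

/-- In the coordinates `x₀ ± x₁`, the planar simple random walk is a pair of independent simple
random walks on `ℤ`. -/
lemma stepLaw_singleton_eq_mul [IsProbabilityMeasure μ] (h : IsSimpleJump μ) (m : ℕ)
    (x : Fin 2 → ℤ) :
    (stepLaw μ m).real {x} = simpleProb m (x 0 + x 1) * simpleProb m (x 0 - x 1) := by
  induction m generalizing x with
  | zero =>
    simp only [stepLaw, simpleProb, measureReal_def]
    by_cases hx : x = 0
    · subst hx; simp
    · have : ¬ (x 0 + x 1 = 0 ∧ x 0 - x 1 = 0) := by
        rintro ⟨h1, h2⟩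
        apply hx
        ext i
        fin_cases i <;> simp <;> omega
      rw [Measure.dirac_apply' _ (measurableSet_singleton x), Set.indicator_of_notMem
        (by simpa using Ne.symm hx)]
      rcases not_and_or.1 this with h' | h' <;> simp [h']
  | succ m ih =>
    rw [stepLaw_succ_singleton h, ih, ih, ih, ih]
    have e1 : x 0 - 1 + x 1 = x 0 + x 1 - 1 := by ring
    have e2 : x 0 + 1 + x 1 = x 0 + x 1 + 1 := by ring
    have e3 : x 0 + (x 1 - 1) = x 0 + x 1 - 1 := by ring
    have e4 : x 0 + (x 1 + 1) = x 0 + x 1 + 1 := by ring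
    have e5 : x 0 - 1 - x 1 = x 0 - x 1 - 1 := by ring
    have e6 : x 0 + 1 - x 1 = x 0 - x 1 + 1 := by ring
    have e7 : x 0 - (x 1 - 1) = x 0 - x 1 + 1 := by ring
    have e8 : x 0 - (x 1 + 1) = x 0 - x 1 - 1 := by ring
    simp only [Pi.sub_apply, Matrix.cons_val_zero, Matrix.cons_val_one, sub_zero,
      sub_neg_eq_add, simpleProb, e1, e2, e3, e4, e5, e6, e7, e8]
    ring

lemma IsSimpleJump.uniformLocalBound [IsProbabilityMeasure μ] (h : IsSimpleJump μ) :
    UniformLocalBound μ (4 : ℝ≥0) := by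
  intro m x
  have key : (stepLaw μ m).real {x} ≤ 4 / (m + 1 : ℕ) := by
    rw [stepLaw_singleton_eq_mul h]
    have h1 := simpleProb_sq_le m (x 0 + x 1)
    have h2 := simpleProb_sq_le m (x 0 - x 1)
    push_cast
    nlinarith [sq_nonneg (simpleProb m (x 0 + x 1) - simpleProb m (x 0 - x 1))]
  rw [← ofReal_measureReal]
  refine (ENNReal.ofReal_le_ofReal key).trans (le_of_eq ?_)
  rw [ENNReal.ofReal_div_of_pos (by positivity), ENNReal.ofReal_natCast]
  simp

/-- The return probabilities vanish at odd times, so consecutive ones are averaged first. -/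
lemma IsSimpleJump.tendsto_green [IsProbabilityMeasure μ] (h : IsSimpleJump μ) :
    Tendsto (fun n : ℕ => (∑ m ∈ Finset.range n, (stepLaw μ m).real {0}) / Real.log n) atTop
      (𝓝 (1 / Real.pi)) := by
  set p : ℕ → ℝ := fun m => (stepLaw μ m).real {0} with hp
  have hpi := Real.pi_pos
  have hpm : ∀ m, p m = simpleProb m 0 ^ 2 := fun m => by
    simp only [hp]; rw [stepLaw_singleton_eq_mul h]; simp [sq]
  have heven : ∀ j, p (2 * j) = 1 / ((2 * j + 1) * Real.Wallis.W j) := fun j => by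
    rw [hpm, simpleProb_two_mul_zero_sq]
  have hodd : ∀ j, p (2 * j + 1) = 0 := fun j => by
    rw [hpm, simpleProb_eq_zero_of_odd _ _ ⟨j, by push_cast; ring⟩]; simp
  have hpair : ∀ m, p m + p (m + 1) = p (2 * ((m + 1) / 2)) := by
    intro m
    rcases Nat.even_or_odd' m with ⟨j, rfl | rfl⟩
    · rw [hodd, add_zero]; congr 1; omega
    · rw [hodd, zero_add]; congr 1; omega
  have hhalf : Tendsto (fun m : ℕ => (m + 1) / 2) atTop atTop :=
    tendsto_atTop_atTop.2 fun b => ⟨2 * b, fun a ha => by omega⟩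
  have hratio : Tendsto (fun m : ℕ => ((m : ℝ) + 1) / (2 * ((m + 1) / 2 : ℕ) + 1)) atTop
      (𝓝 1) := by
    have h1 : Tendsto (fun m : ℕ => 1 - 1 / ((m : ℝ) + 2)) atTop (𝓝 (1 - 0)) := by
      refine tendsto_const_nhds.sub (tendsto_const_nhds.div_atTop ?_)
      exact tendsto_atTop_add_const_right _ _ tendsto_natCast_atTop_atTop
    rw [sub_zero] at h1
    refine tendsto_of_tendsto_of_tendsto_of_le_of_le h1 tendsto_const_nhds ?_ ?_
    · intro m
      have : (2 * ((m + 1) / 2 : ℕ) + 1 : ℝ) ≤ m + 2 := by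
        exact_mod_cast (by omega : 2 * ((m + 1) / 2) + 1 ≤ m + 2)
      calc 1 - 1 / ((m : ℝ) + 2) = ((m : ℝ) + 1) / (m + 2) := by field_simp; ring
        _ ≤ _ := div_le_div_of_nonneg_left (by positivity) (by positivity) this
    · intro m
      have : ((m : ℝ) + 1) ≤ 2 * ((m + 1) / 2 : ℕ) + 1 := by
        exact_mod_cast (by omega : m + 1 ≤ 2 * ((m + 1) / 2) + 1)
      exact (div_le_one (by positivity)).2 this
  have hW : Tendsto (fun m : ℕ => (Real.Wallis.W ((m + 1) / 2))⁻¹) atTop (𝓝 (Real.pi / 2)⁻¹) :=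
    (Real.Wallis.tendsto_W_nhds_pi_div_two.comp hhalf).inv₀ (by positivity)
  have hlim : Tendsto (fun m : ℕ => ((m : ℝ) + 1) * ((p m + p (m + 1)) / 2)) atTop
      (𝓝 (1 / Real.pi)) := by
    have h1 := (hratio.mul hW).div_const 2
    rw [show 1 * (Real.pi / 2)⁻¹ / 2 = 1 / Real.pi by field_simp] at h1
    refine h1.congr fun m => ?_
    rw [hpair, heven]
    have := Real.Wallis.W_pos ((m + 1) / 2)
    field_simp
  have hsum := tendsto_sum_range_div_log hlim
  have hbd : Tendsto (fun n : ℕ => ((p n - p 0) / 2) / Real.log n) atTop (𝓝 0) := by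
    refine squeeze_zero_norm' (a := fun n : ℕ => 1 / Real.log n) ?_
      (tendsto_const_nhds.div_atTop tendsto_log_natCast)
    filter_upwards [tendsto_log_natCast.eventually_gt_atTop 0] with n hn
    have hp1 : ∀ m, p m ≤ 1 := fun m => measureReal_le_one
    have hp0 : ∀ m, 0 ≤ p m := fun m => measureReal_nonneg
    rw [Real.norm_eq_abs, abs_div, abs_of_pos hn]
    gcongr
    rw [abs_le]
    constructor <;> linarith [hp1 n, hp0 n, hp1 0, hp0 0]
  have h2 := hsum.sub hbd
  rw [sub_zero] at h2
  refine h2.congr fun n => ?_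
  have h3 : ∑ m ∈ Finset.range n, (p m + p (m + 1)) / 2
      = ∑ m ∈ Finset.range n, p m + (p n - p 0) / 2 := by
    rw [← Finset.sum_range_sub p n, ← Finset.sum_div, Finset.sum_add_distrib,
      Finset.sum_sub_distrib]
    ring
  rw [h3]
  ring

end Planar

/-! ### Walks whose Green's function grows logarithmically -/

lemma selfIntersection_one (ξ : ℕ → Ω → Fin d → ℤ) (n : ℕ) (ω : Ω) :
    selfIntersection ξ n 1 ω = n := by
  rw [selfIntersection_eq_sum_powDiff ξ n 0]
  have : ∀ m ∈ Finset.Ico 1 (n + 1),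
      powDiff (0 + 1) (visits (shift m ξ) (n + 1 - m) 0 ω) = 1 := by
    intro m hm
    have hm' := (Finset.mem_Ico.1 hm).2
    rw [powDiff_eq_sum 0 (one_le_visits_zero _ (by omega) ω)]
    simp
  rw [Finset.sum_congr rfl this]
  simp

section

variable [MeasurableSpace Ω] {P : Measure Ω} {μ : Measure (Fin d → ℤ)} [IsProbabilityMeasure P]

/-- For `k = 1` the exponent `2k - 4` is negative, but `L_n(1) = n` has no variance. -/
lemma isBigO_variance_selfIntersection {ξ : ℕ → Ω → Fin d → ℤ} (h : IsIIDJumps P μ ξ) {C : ℝ≥0}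
    (hC : UniformLocalBound μ C) (i : ℕ) :
    (fun n : ℕ => Var[selfIntersection ξ n (i + 1); P]) =O[atTop]
      fun n : ℕ => (n : ℝ) ^ 2 * Real.log n ^ (2 * (i : ℤ) - 2) := by
  rcases i with _ | κ
  · have : ∀ n, Var[selfIntersection ξ n (0 + 1); P] = 0 := fun n => by
      have e : selfIntersection ξ n (0 + 1) = fun _ => (n : ℝ) :=
        funext fun ω => selfIntersection_one ξ n ω
      rw [e, variance, evariance]
      simp
    simp_rw [this]
    exact isBigO_zero _ _
  · obtain ⟨K, hK0, hK⟩ := variance_selfIntersection_le (P := P) hC κ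
    refine IsBigO.of_bound (K * 3 ^ (2 * κ)) ?_
    filter_upwards [tendsto_log_natCast.eventually_ge_atTop 1, eventually_ge_atTop 1] with n hn hn1
    have hh : (harmonic (n + 1) : ℝ) ≤ 3 * Real.log n := by
      have h1 := harmonic_le_one_add_log (n + 1)
      have hn' : (1 : ℝ) ≤ n := by exact_mod_cast hn1
      have h2 : Real.log ((n + 1 : ℕ) : ℝ) ≤ Real.log (Real.exp 1 * n) := by
        refine Real.log_le_log (by positivity) ?_
        push_cast
        have := Real.add_one_le_exp (1 : ℝ)
        nlinarith
      rw [Real.log_mul (Real.exp_pos 1).ne' (by positivity), Real.log_exp] at h2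
      linarith
    have e : (2 * ((κ + 1 : ℕ) : ℤ) - 2) = ((2 * κ : ℕ) : ℤ) := by push_cast; ring
    rw [e, zpow_natCast, Real.norm_of_nonneg (variance_nonneg _ _),
      Real.norm_of_nonneg (by positivity)]
    calc _ ≤ K * ((n : ℝ) ^ 2 * (harmonic (n + 1) : ℝ) ^ (2 * κ)) := hK n ξ h
      _ ≤ K * ((n : ℝ) ^ 2 * (3 * Real.log n) ^ (2 * κ)) := by
          gcongr
          exact harmonic_nonneg _
      _ = _ := by rw [mul_pow]; ring

/-- Mean, variance and strong law for any walk with the uniform local bound whose Green's function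
at the origin grows like `log n / (πγ)`. -/
theorem selfIntersection_asymptotics {ξ : ℕ → Ω → Fin d → ℤ} (h : IsIIDJumps P μ ξ) {C : ℝ≥0}
    (hC : UniformLocalBound μ C) {γ : ℝ} (hγ : 0 < γ)
    (hg : Tendsto (fun n : ℕ => (∑ m ∈ Finset.range n, (stepLaw μ m).real {0}) / Real.log n)
      atTop (𝓝 (1 / (Real.pi * γ)))) (k : ℕ) (hk : 1 ≤ k) :
    (∀ n, MemLp (selfIntersection ξ n k) 2 P) ∧
    (fun n : ℕ => ∫ ω, selfIntersection ξ n k ω ∂P) ~[atTop]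
      (fun n : ℕ => Real.Gamma (k + 1) / (Real.pi * γ) ^ (k - 1) *
        (n * Real.log n ^ (k - 1))) ∧
    (fun n : ℕ => variance (selfIntersection ξ n k) P) =O[atTop]
      (fun n : ℕ => (n : ℝ) ^ 2 * Real.log n ^ (2 * (k : ℤ) - 4)) ∧
    ∀ᵐ ω ∂P, Tendsto
      (fun n : ℕ => (Real.pi * γ) ^ (k - 1) / (n * Real.log n ^ (k - 1)) *
        selfIntersection ξ n k ω)
      atTop (𝓝 (Real.Gamma (k + 1))) := by
  obtain ⟨i, rfl⟩ : ∃ i, k = i + 1 := ⟨k - 1, by omega⟩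
  have hpi := Real.pi_pos
  have hfac : (0 : ℝ) < (i + 1).factorial := by exact_mod_cast (i + 1).factorial_pos
  have hE := tendsto_integral_selfIntersection h hg i
  have hV := isBigO_variance_selfIntersection h hC i
  have hz : (2 * ((i + 1 : ℕ) : ℤ) - 4) = 2 * (i : ℤ) - 2 := by push_cast; ring
  rw [Real.Gamma_nat_eq_factorial, Nat.add_sub_cancel, hz]
  refine ⟨fun n => memLp_selfIntersection h.meas n hk 2, ?_, hV, ?_⟩
  · refine isEquivalent_of_tendsto_one ?_
    have h1 := hE.div_const ((i + 1).factorial * (1 / (Real.pi * γ)) ^ i)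
    rw [div_self (by positivity)] at h1
    refine h1.congr fun n => ?_
    simp only [Pi.div_apply]
    rw [div_div, one_div, inv_pow]
    congr 1
    rw [div_eq_mul_inv]
    ring
  · filter_upwards [ae_tendsto_selfIntersection h.meas hE hV] with ω hω
    have h1 := hω.const_mul ((Real.pi * γ) ^ i)
    have e : (Real.pi * γ) ^ i * ((i + 1).factorial * (1 / (Real.pi * γ)) ^ i)
        = (i + 1).factorial := by
      rw [one_div, inv_pow]; field_simp
    rw [e] at h1
    refine h1.congr fun n => ?_
    ring

end

end LatticeWalk

theorem mainTheorem6 {Ω : Type*} [MeasurableSpace Ω] (P : Measure Ω) [IsProbabilityMeasure P]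
    {d : ℕ} (μ : Measure (Fin d → ℤ)) (ξ : ℕ → Ω → Fin d → ℤ)
    (hmeas : ∀ i, Measurable (ξ i)) (hindep : iIndepFun ξ P) (hlaw : ∀ i, P.map (ξ i) = μ)
    (γd : ℝ)
    (hξ : (d = 1 ∧ LatticeWalk.StronglyAperiodic μ ∧ LatticeWalk.HasOneStableExpansion μ γd) ∨
      (d = 2 ∧ LatticeWalk.IsSimpleJump μ ∧ γd = 2 * √(LatticeWalk.covMatrix μ).det))
    (k : ℕ) (hk : 1 ≤ k) :
    (∀ n, MemLp (LatticeWalk.selfIntersection ξ n k) 2 P) ∧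
    (fun n : ℕ => ∫ ω, LatticeWalk.selfIntersection ξ n k ω ∂P) ~[atTop]
      (fun n : ℕ => Real.Gamma (k + 1) / (Real.pi * γd) ^ (k - 1) *
        (n * Real.log n ^ (k - 1))) ∧
    (fun n : ℕ => variance (LatticeWalk.selfIntersection ξ n k) P) =O[atTop]
      (fun n : ℕ => (n : ℝ) ^ 2 * Real.log n ^ (2 * (k : ℤ) - 4)) ∧
    ∀ᵐ ω ∂P, Tendsto
      (fun n : ℕ => (Real.pi * γd) ^ (k - 1) / (n * Real.log n ^ (k - 1)) *
        LatticeWalk.selfIntersection ξ n k ω)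
      atTop (𝓝 (Real.Gamma (k + 1))) := by
  have h : LatticeWalk.IsIIDJumps P μ ξ := ⟨hmeas, hindep, hlaw⟩
  have : IsProbabilityMeasure μ := h.isProbabilityMeasure
  rcases hξ with ⟨rfl, hs, hexp⟩ | ⟨rfl, hsimple, hγ⟩
  · obtain ⟨c, hc0, hc⟩ := LatticeWalk.norm_phi_le_exp hs hexp
    obtain ⟨C, hC⟩ := LatticeWalk.uniformLocalBound_of_phi_le hc0 hc
    exact LatticeWalk.selfIntersection_asymptotics h hC hexp.1
      (LatticeWalk.tendsto_green_of_expansion hs hexp) k hk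
  · have hγ1 : γd = 1 := hγ.trans hsimple.covMatrix_det
    refine LatticeWalk.selfIntersection_asymptotics h hsimple.uniformLocalBound
      (hγ1 ▸ one_pos) ?_ k hk
    rw [hγ1, mul_one]
    exact hsimple.tendsto_green
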